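/- Write $(x;q)_n=\prod_{j=0}^{n-1}(1-xq^j)$, $(x;q)_\infty=\prod_{j\ge 0}(1-xq^j)$ and $(x_1,\dots,x_k;q)_n=(x_1;q)_n\cdots(x_k;q)_n$ (also for $n=\infty$). For $X\in\{A1,A3,E2,E4\}$ let $$S_X(z,q)=\frac{P_X(q)}{(z,z^{-1};q)_\infty}\sum_{n=1}^\infty (z,z^{-1};q)_n\,\beta^X_n\,q^n=\sum_{n=1}^\infty\sum_{m=-\infty}^\infty M_X(m,n)z^mq^n\in\mathbb Z[z,z^{-1}][[q]],$$ where the $n$-th term of the first sum, together with the prefactor, is understood as $P_X(q)\beta^X_nq^n/(zq^n,z^{-1}q^n;q)_\infty$, expanded in powers of $q$, and $$P_{A1}=P_{A3}=(q;q)_\infty,\quad P_{E2}=P_{E4}=(q^2;q^2)_\infty,$$ $$\beta^{A1}_n=\frac{1}{(q;q)_{2n}},\quad \beta^{A3}_n=\frac{q^n}{(q;q)_{2n}},\quad \beta^{E2}_n=\frac{(-1)^n}{(q^2;q^2)_n},\quad \beta^{E4}_n=\frac{q^n}{(q^2;q^2)_n}.$$ For an integer $k$ and a positive integer $t$ put $M_X(k,t,n)=\sum_{m\equiv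 k\ (\mathrm{mod}\ t)}M_X(m,n)$. For a non-empty partition $\pi$ let $s(\pi)$ be its smallest part. Let $PP$ be the set of pairs of partitions $(\pi_1,\pi_2)$ such that $\pi_1$ is non-empty and all parts of $\pi_2$ are larger than $s(\pi_1)$ but no more than $2s(\pi_1)$; $(\pi_1,\pi_2)$ is a pair of $n$ if the sum of all parts of $\pi_1$ and $\pi_2$ is $n$. An overpartition is a partition in which the first occurrence of each part may be overlined; let $\overline{P}$ be the set of non-empty overpartitions whose smallest part is not overlined. For $n\ge 0$ define: - $\mathrm{spt}_{A1}(n)$, the sum over $(\pi_1,\pi_2)\in PP$ of $n$ of the number of times $s(\pi_1)$ appears in $\pi_1$; - $\mathrm{spt}_{A3}(n)$, the sum over $(\pi_1,\pi_2)\in PP$ of $n$ of one less than the number of times $s(\pi_1)$ appears in $\pi_1$; - $\mathrm{spt}_{E2}(n)$, the sum over $\pi\in\overline{P}$ of $n$ of $(-1)^{s(\pi)}$ times the number of times $s(\pi)$ appears in $\pi$; - $\mathrm{spt}_{E4}(n)$, the sum over $\pi\in\overline{P}$ of $n$ of one less than the number of times $s(\pi)$ appears in $\pi$. Then for every integer $n\ge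 0$, \begin{align*} M_{A1}(0,3,3n)&=M_{A1}(1,3,3n)=M_{A1}(2,3,3n)=\tfrac13\,\mathrm{spt}_{A1}(3n),\\ M_{A3}(0,3,3n+1)&=M_{A3}(1,3,3n+1)=M_{A3}(2,3,3n+1)=\tfrac13\,\mathrm{spt}_{A3}(3n+1),\\ M_{E2}(0,3,3n)&=M_{E2}(1,3,3n)=M_{E2}(2,3,3n)=\tfrac13\,\mathrm{spt}_{E2}(3n),\\ M_{E4}(0,3,3n+1)&=M_{E4}(1,3,3n+1)=M_{E4}(2,3,3n+1)=\tfrac13\,\mathrm{spt}_{E4}(3n+1). \end{align*} -/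

import Mathlib

open Finset PowerSeries

noncomputable section

namespace SptCrank

/-- The ring `ℤ[z, z⁻¹]⟦q⟧`; the variable `q` is `PowerSeries.X`. -/
abbrev ZQ : Type := PowerSeries (LaurentPolynomial ℤ)

/-- The variable `z`, as an element of `ℤ[z, z⁻¹]`. -/
def z : LaurentPolynomial ℤ := LaurentPolynomial.T 1

/-- The inverse `z⁻¹`, as an element of `ℤ[z, z⁻¹]`. -/
def zInv : LaurentPolynomial ℤ := LaurentPolynomial.T (-1)

/-- The finite product `(x q^a; q^b)_n = ∏_{j=0}^{n-1} (1 - x q^(a + b j))`. -/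
def qPoch (x : LaurentPolynomial ℤ) (a b n : ℕ) : ZQ :=
  ∏ j ∈ range n, (1 - C x * X ^ (a + b * j))

/-- The infinite product `(x q^a; q^b)_∞ = ∏_{j ≥ 0} (1 - x q^(a + b j))`, for `b ≥ 1`: the factors
with `j > N` do not affect the coefficient of `q^N` (see `coeff_qPochInf`). -/
def qPochInf (x : LaurentPolynomial ℤ) (a b : ℕ) : ZQ :=
  PowerSeries.mk fun N => coeff N (qPoch x a b (N + 1))

/-- The multiplicative inverse of a series in `q` with constant term `1`. -/
def qInv (f : ZQ) : ZQ := invOfUnit f 1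

/-- The series `∑_{n ≥ 1} q^n f_n`: the terms with `n > N` do not affect the coefficient
of `q^N`. -/
def qSum (f : ℕ → ZQ) : ZQ :=
  PowerSeries.mk fun N => ∑ n ∈ Icc 1 N, coeff N (X ^ n * f n)

/-- The spt-crank-type series
`P / (z, z⁻¹; q)_∞ * ∑_{n ≥ 1} (z, z⁻¹; q)_n β_n q^n`, an element of `ℤ[z, z⁻¹]⟦q⟧`. Since
`(z; q)_∞ = (z; q)_n (z q^n; q)_∞`, its `n`-th term is `P β_n q^n / (z q^n, z⁻¹ q^n; q)_∞`,
whose denominator has constant term `1` (see `qPochInf_mul_sptCrank`). -/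
def sptCrank (P : ZQ) (β : ℕ → ZQ) : ZQ :=
  qSum fun n => P * β n * qInv (qPochInf z n 1 * qPochInf zInv n 1)

/-- `β_n = 1 / (q; q)_{2n}`. -/
def betaA1 (n : ℕ) : ZQ := qInv (qPoch 1 1 1 (2 * n))

/-- `β_n = q^n / (q; q)_{2n}`. -/
def betaA3 (n : ℕ) : ZQ := X ^ n * qInv (qPoch 1 1 1 (2 * n))

/-- `β_n = (-1)^n / (q²; q²)_n`. -/
def betaE2 (n : ℕ) : ZQ := (-1) ^ n * qInv (qPoch 1 2 2 n)

/-- `β_n = q^n / (q²; q²)_n`. -/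
def betaE4 (n : ℕ) : ZQ := X ^ n * qInv (qPoch 1 2 2 n)

/-- `S_{A1}(z, q)`, with prefactor `(q; q)_∞`. -/
def SA1 : ZQ := sptCrank (qPochInf 1 1 1) betaA1

/-- `S_{A3}(z, q)`, with prefactor `(q; q)_∞`. -/
def SA3 : ZQ := sptCrank (qPochInf 1 1 1) betaA3

/-- `S_{E2}(z, q)`, with prefactor `(q²; q²)_∞`. -/
def SE2 : ZQ := sptCrank (qPochInf 1 2 2) betaE2

/-- `S_{E4}(z, q)`, with prefactor `(q²; q²)_∞`. -/
def SE4 : ZQ := sptCrank (qPochInf 1 2 2) betaE4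

/-- `M(m, n)`, the coefficient of `z^m q^n` in `S(z, q)`. -/
def M (S : ZQ) (m : ℤ) (n : ℕ) : ℤ := (coeff n S).coeff m

/-- `M(k, t, n) = ∑_{m ≡ k (mod t)} M(m, n)`, a sum with finitely many nonzero terms. -/
def Mmod (S : ZQ) (k : ℤ) (t n : ℕ) : ℤ :=
  ∑ m ∈ (coeff n S).coeff.support with m ≡ k [ZMOD t], M S m n

/-- The smallest part of a partition given as a multiset of parts (`0` for the empty partition). -/
def smallest (s : Multiset ℕ) : ℕ := s.toFinset.min.untopD 0

/-- The number of times the smallest part appears. -/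
def smallestCount (s : Multiset ℕ) : ℕ := s.count (smallest s)

/-- The partition pairs `(π₁, π₂)` of `n` such that `π₁` is non-empty and all parts of `π₂` are
larger than the smallest part `s` of `π₁` but no more than `2 s`. -/
def partitionPairs (n : ℕ) : Finset (Σ i : ℕ × ℕ, i.1.Partition × i.2.Partition) :=
  ((antidiagonal n).sigma fun _ => univ).filter fun p =>
    p.2.1.parts ≠ 0 ∧
      ∀ a ∈ p.2.2.parts, smallest p.2.1.parts < a ∧ a ≤ 2 * smallest p.2.1.parts

/-- The non-empty overpartitions of `n` whose smallest part is not overlined. An overpartition is a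
partition together with the set of those part sizes whose first occurrence is overlined. -/
def overpartitions (n : ℕ) : Finset (Σ _ : n.Partition, Finset ℕ) :=
  (univ.sigma fun π : n.Partition => π.parts.toFinset.powerset).filter fun p =>
    p.1.parts ≠ 0 ∧ smallest p.1.parts ∉ p.2

/-- `spt_{A1}(n)`: partition pairs, weighted by the number of times `s(π₁)` appears. -/
def sptA1 (n : ℕ) : ℤ := ∑ p ∈ partitionPairs n, (smallestCount p.2.1.parts : ℤ)

/-- `spt_{A3}(n)`: partition pairs, weighted by one less than the number of times `s(π₁)`
appears. -/
def sptA3 (n : ℕ) : ℤ := ∑ p ∈ partitionPairs n, ((smallestCount p.2.1.parts : ℤ) - 1)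

/-- `spt_{E2}(n)`: overpartitions, weighted by `(-1)^{s(π)}` times the number of times `s(π)`
appears. -/
def sptE2 (n : ℕ) : ℤ :=
  ∑ p ∈ overpartitions n, (-1) ^ smallest p.1.parts * (smallestCount p.1.parts : ℤ)

/-- `spt_{E4}(n)`: overpartitions, weighted by one less than the number of times `s(π)`
appears. -/
def sptE4 (n : ℕ) : ℤ := ∑ p ∈ overpartitions n, ((smallestCount p.1.parts : ℤ) - 1)

/-! Sanity facts: the infinite products and the spt-crank-type series are the intended ones. -/

theorem coeff_qPoch_succ (x : LaurentPolynomial ℤ) (a b N K : ℕ) (hb : 1 ≤ b) (hK : N + 1 ≤ K) :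
    coeff N (qPoch x a b (K + 1)) = coeff N (qPoch x a b K) := by
  have hlt : N < a + b * K := by nlinarith
  have h : qPoch x a b (K + 1)
      = qPoch x a b K - (qPoch x a b K * C x) * X ^ (a + b * K) := by
    unfold qPoch
    rw [prod_range_succ]
    ring
  rw [h, map_sub, coeff_mul_X_pow', if_neg (by omega), sub_zero]

theorem coeff_qPochInf (x : LaurentPolynomial ℤ) (a b N K : ℕ) (hb : 1 ≤ b) (hK : N + 1 ≤ K) :
    coeff N (qPochInf x a b) = coeff N (qPoch x a b K) := by
  induction K, hK using Nat.le_induction with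
  | base => simp [qPochInf]
  | succ K hK ih => rw [ih, coeff_qPoch_succ x a b N K hb hK]

theorem qPochInf_eq_mul (x : LaurentPolynomial ℤ) (n : ℕ) :
    qPochInf x 0 1 = qPoch x 0 1 n * qPochInf x n 1 := by
  ext1 N
  have h : qPoch x 0 1 (n + (N + 1)) = qPoch x 0 1 n * qPoch x n 1 (N + 1) := by
    simp [qPoch, prod_range_add]
  rw [coeff_qPochInf x 0 1 N (n + (N + 1)) le_rfl (by omega), h, coeff_mul, coeff_mul]
  refine sum_congr rfl fun p hp => ?_
  have hp' := mem_antidiagonal.1 hp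
  rw [coeff_qPochInf x n 1 p.2 (N + 1) le_rfl (by omega)]

theorem constantCoeff_qPochInf (x : LaurentPolynomial ℤ) (a b : ℕ) (ha : 1 ≤ a) :
    constantCoeff (qPochInf x a b) = 1 := by
  have ha' : a ≠ 0 := by omega
  rw [← coeff_zero_eq_constantCoeff_apply]
  simp [qPochInf, qPoch, ha']

theorem mul_qInv {f : ZQ} (hf : constantCoeff f = 1) : f * qInv f = 1 :=
  mul_invOfUnit f 1 (by simpa using hf)

theorem mul_qSum (A : ZQ) (f : ℕ → ZQ) : A * qSum f = qSum fun n => A * f n := by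
  ext1 N
  have h : ∀ p ∈ antidiagonal N, coeff p.2 (qSum f) = ∑ n ∈ Icc 1 N, coeff p.2 (X ^ n * f n) := by
    intro p hp
    have hp' := mem_antidiagonal.1 hp
    simp only [qSum, coeff_mk]
    refine sum_subset (Icc_subset_Icc le_rfl (by omega)) fun n h1 h2 => ?_
    rw [coeff_X_pow_mul', if_neg]
    simp only [mem_Icc] at h1 h2
    omega
  rw [coeff_mul, sum_congr rfl fun p hp => by rw [h p hp, mul_sum], sum_comm]
  simp only [qSum, coeff_mk]
  refine sum_congr rfl fun n _ => ?_
  rw [← coeff_mul]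
  congr 1
  ring

theorem qPochInf_mul_sptCrank (P : ZQ) (β : ℕ → ZQ) :
    qPochInf z 0 1 * qPochInf zInv 0 1 * sptCrank P β
      = P * qSum fun n => qPoch z 0 1 n * qPoch zInv 0 1 n * β n := by
  rw [sptCrank, mul_qSum, mul_qSum]
  ext1 N
  simp only [qSum, coeff_mk]
  refine sum_congr rfl fun n hn => ?_
  have hn' : 1 ≤ n := (mem_Icc.1 hn).1
  have hc := mul_qInv (f := qPochInf z n 1 * qPochInf zInv n 1)
    (by rw [map_mul, constantCoeff_qPochInf _ n 1 hn', constantCoeff_qPochInf _ n 1 hn', mul_one])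
  rw [qPochInf_eq_mul z n, qPochInf_eq_mul zInv n]
  generalize qInv (qPochInf z n 1 * qPochInf zInv n 1) = I at *
  generalize qPochInf z n 1 = A at *
  generalize qPochInf zInv n 1 = B at *
  generalize qPoch z 0 1 n = D
  generalize qPoch zInv 0 1 n = E
  generalize β n = b
  have h : (D * A) * (E * B) * (P * b * I) = P * (D * E * b) := by
    calc (D * A) * (E * B) * (P * b * I) = P * (D * E * b) * (A * B * I) := by ring
      _ = P * (D * E * b) := by rw [hc, mul_one]
  rw [h]

end SptCrank

end

/-! Fix a series `S` and a cube root of unity ω ≠ 1. Since 1 and ω are linearly independent over ℚ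
and 1 + ω + ω² = 0, the three class sums at `n` agree exactly when the coefficient of `q^n` in `S(ω,
q)` vanishes. Their total is the coefficient in `S(1, q)`, which is the spt number. So two things
are needed: a vanishing statement at z = ω and a generating function at z = 1.

At z = ω, the product of `(q; q)_∞` with the denominator is `3 (q³; q³)_∞`, a series in `q³`.
Multiplying by it cannot create or destroy the absence of a residue class of exponents
(`Avoids.of_mul`), so the denominator may be cleared. Next, `(z, 1/z; q)_n / (q; q)_{2n}` is
expanded over `r` in a Bailey-type sum with coefficients `A_r = (z^{r+1} + z^{-r}) / (1 + z)`. These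
are all 1 at z = 1, where the left side vanishes for n ≥ 1, and repeat 1, -2, 1 at z = ω.
Subtracting leaves only the indices `r ≡ 1 (mod 3)`, with factor -3 (`prod_cube_mul_qr`). For such
`r` the exponent `r(r-1)/2` is divisible by 3, so each inner sum over `n` can be treated separately.

The inner sums are evaluated by telescoping in `n`. For A1, A3 and E4 this gives recurrences in `r`
(`partialThetaA_rec`, `partialThetaE_rec`) whose exponents avoid the required class. For E2 it is a
case of the q-Gauss sum, equal up to sign to `q^r ∑ (-1)^n q^{n²}`; no square is 2 modulo 3, so no
exponent is divisible by 3.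

At z = 1 the `n`-th term of the series generates exactly the objects with smallest part `n`: `q^n /
(1 - q^n)²` weights multiplicities, and the remaining products describe the larger parts (`spt_A`,
`spt_E`). -/

namespace SptCrank

open Filter

/-! ### Coefficientwise limits and infinite sums of power series -/

section Limits

variable {R : Type*} [CommRing R]

/-- Coefficientwise eventual equality of a sequence of power series with a limit. -/
def SeriesLim (s : ℕ → R⟦X⟧) (L : R⟦X⟧) : Prop :=
  ∀ N, ∀ᶠ k in atTop, coeff N (s k) = coeff N L

theorem SeriesLim.const (L : R⟦X⟧) : SeriesLim (fun _ => L) L :=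
  fun _ => Eventually.of_forall fun _ => rfl

theorem SeriesLim.mul {s t : ℕ → R⟦X⟧} {L L' : R⟦X⟧} (hs : SeriesLim s L) (ht : SeriesLim t L') :
    SeriesLim (fun k => s k * t k) (L * L') := by
  intro N
  have h : ∀ᶠ k in atTop, ∀ p ∈ antidiagonal N,
      coeff p.1 (s k) = coeff p.1 L ∧ coeff p.2 (t k) = coeff p.2 L' :=
    (eventually_all_finset _).2 fun p _ => (hs p.1).and (ht p.2)
  filter_upwards [h] with k hk
  rw [coeff_mul, coeff_mul]
  exact sum_congr rfl fun p hp => by rw [(hk p hp).1, (hk p hp).2]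

theorem SeriesLim.add {s t : ℕ → R⟦X⟧} {L L' : R⟦X⟧} (hs : SeriesLim s L) (ht : SeriesLim t L') :
    SeriesLim (fun k => s k + t k) (L + L') := by
  intro N
  filter_upwards [hs N, ht N] with k h1 h2
  rw [map_add, map_add, h1, h2]

theorem SeriesLim.sub {s t : ℕ → R⟦X⟧} {L L' : R⟦X⟧} (hs : SeriesLim s L) (ht : SeriesLim t L') :
    SeriesLim (fun k => s k - t k) (L - L') := by
  intro N
  filter_upwards [hs N, ht N] with k h1 h2
  rw [map_sub, map_sub, h1, h2]

theorem SeriesLim.unique {s : ℕ → R⟦X⟧} {L L' : R⟦X⟧} (hs : SeriesLim s L)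
    (hs' : SeriesLim s L') : L = L' := by
  ext N
  obtain ⟨k, h1, h2⟩ := ((hs N).and (hs' N)).exists
  rw [← h1, h2]

theorem SeriesLim.comp {s : ℕ → R⟦X⟧} {L : R⟦X⟧} (hs : SeriesLim s L) {φ : ℕ → ℕ}
    (hφ : Tendsto φ atTop atTop) : SeriesLim (fun k => s (φ k)) L :=
  fun N => hφ.eventually (hs N)

theorem SeriesLim.congr {s t : ℕ → R⟦X⟧} {L : R⟦X⟧} (hs : SeriesLim s L)
    (h : ∀ᶠ k in atTop, s k = t k) : SeriesLim t L := by
  intro N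
  filter_upwards [hs N, h] with k h1 h2
  rw [← h2, h1]

theorem SeriesLim.map {S : Type*} [CommRing S] (φ : R →+* S) {s : ℕ → R⟦X⟧} {L : R⟦X⟧}
    (hs : SeriesLim s L) : SeriesLim (fun k => PowerSeries.map φ (s k)) (PowerSeries.map φ L) := by
  intro N
  filter_upwards [hs N] with k h
  rw [coeff_map, coeff_map, h]

theorem tendsto_sub_atTop (a : ℕ) : Tendsto (fun k => k - a) atTop atTop :=
  tendsto_sub_atTop_nat a

theorem tendsto_shift (a : ℕ) : Tendsto (fun k => k + a) atTop atTop :=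
  tendsto_add_atTop_nat a

theorem tendsto_two_mul : Tendsto (fun k : ℕ => 2 * k) atTop atTop :=
  tendsto_atTop_mono (fun k => by show k ≤ 2 * k; omega) tendsto_id

theorem seriesLim_X_pow_mul (s : ℕ → R⟦X⟧) {φ : ℕ → ℕ} (hφ : Tendsto φ atTop atTop) :
    SeriesLim (fun k => X ^ φ k * s k) 0 := by
  intro N
  filter_upwards [hφ.eventually_gt_atTop N] with k hk
  rw [coeff_X_pow_mul', if_neg (by omega), map_zero]

/-- The limit of a sequence whose consecutive terms `k`, `k + 1` agree below degree `k`. -/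
theorem exists_seriesLim {s : ℕ → R⟦X⟧} (h : ∀ k, ∃ g, s (k + 1) = s k + X ^ k * g) :
    SeriesLim s (PowerSeries.mk fun N => coeff N (s (N + 1))) := by
  intro N
  filter_upwards [eventually_ge_atTop (N + 1)] with K hK
  rw [coeff_mk]
  induction K, hK using Nat.le_induction with
  | base => rfl
  | succ K hK ih =>
    obtain ⟨g, hg⟩ := h K
    rw [hg, map_add, coeff_X_pow_mul', if_neg (by omega), add_zero, ih]

/-- The series `∑_{n ≥ 0} q^n f_n`. -/
noncomputable def isum (f : ℕ → R⟦X⟧) : R⟦X⟧ :=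
  PowerSeries.mk fun N => ∑ n ∈ range (N + 1), coeff N (X ^ n * f n)

theorem coeff_isum_of_le (f : ℕ → R⟦X⟧) {N K : ℕ} (h : N + 1 ≤ K) :
    coeff N (isum f) = ∑ n ∈ range K, coeff N (X ^ n * f n) := by
  rw [isum, coeff_mk]
  refine sum_subset (range_subset_range.2 h) fun n _ hn => ?_
  rw [coeff_X_pow_mul', if_neg (by simpa using hn)]

theorem seriesLim_isum (f : ℕ → R⟦X⟧) :
    SeriesLim (fun K => ∑ n ∈ range K, X ^ n * f n) (isum f) := by
  intro N
  filter_upwards [eventually_ge_atTop (N + 1)] with K hK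
  rw [coeff_isum_of_le f hK, map_sum]

theorem mul_isum (A : R⟦X⟧) (f : ℕ → R⟦X⟧) : A * isum f = isum fun n => A * f n := by
  refine (((SeriesLim.const A).mul (seriesLim_isum f)).congr
    (Eventually.of_forall fun K => ?_)).unique (seriesLim_isum _)
  rw [mul_sum]
  exact sum_congr rfl fun n _ => by ring

theorem isum_add (f g : ℕ → R⟦X⟧) : isum (fun n => f n + g n) = isum f + isum g := by
  ext N
  simp [isum, mul_add, sum_add_distrib]

theorem isum_sub (f g : ℕ → R⟦X⟧) : isum (fun n => f n - g n) = isum f - isum g := by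
  ext N
  simp [isum, mul_sub, sum_sub_distrib]

theorem isum_eq_zero_add (f : ℕ → R⟦X⟧) : isum f = f 0 + X * isum fun n => f (n + 1) := by
  refine ((seriesLim_isum f).comp (tendsto_shift 1)).unique
    (((SeriesLim.const (f 0)).add
      ((SeriesLim.const X).mul (seriesLim_isum _))).congr (Eventually.of_forall fun K => ?_))
  rw [sum_range_succ', pow_zero, one_mul, add_comm, mul_sum]
  congr 1
  exact sum_congr rfl fun n _ => by ring

/-- Termwise limits pass to `isum`. -/
theorem SeriesLim.isum {f : ℕ → ℕ → R⟦X⟧} {g : ℕ → R⟦X⟧}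
    (h : ∀ n, SeriesLim (fun k => f k n) (g n)) :
    SeriesLim (fun k => SptCrank.isum (f k)) (SptCrank.isum g) := by
  intro N
  have h' : ∀ᶠ k in atTop, ∀ n ∈ range (N + 1), coeff N (X ^ n * f k n) = coeff N (X ^ n * g n) :=
    (eventually_all_finset _).2 fun n _ => ((SeriesLim.const (X ^ n)).mul (h n)) N
  filter_upwards [h'] with k hk
  simp only [SptCrank.isum, coeff_mk]
  exact sum_congr rfl hk

/-- Telescoping. -/
theorem seriesLim_of_telescope {f T : ℕ → R⟦X⟧} (h : ∀ n, X ^ n * f n = T (n + 1) - T n)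
    (h0 : T 0 = 0) : SeriesLim T (isum f) := by
  refine (seriesLim_isum f).congr (Eventually.of_forall fun K => ?_)
  rw [sum_congr rfl fun n _ => h n, sum_range_sub, h0, sub_zero]

theorem isum_eq_sum {f : ℕ → R⟦X⟧} {K : ℕ} (h : ∀ n, K ≤ n → f n = 0) :
    isum f = ∑ n ∈ range K, X ^ n * f n := by
  refine (seriesLim_isum f).unique ((SeriesLim.const _).congr ?_)
  filter_upwards [eventually_ge_atTop K] with k hk
  exact sum_subset (range_subset_range.2 hk) fun n _ hn => by
    rw [h n (by simpa using hn), mul_zero]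

end Limits

/-! ### q-Pochhammer products and their reciprocals -/

section Products

variable (R : Type*) [CommRing R]

/-- `(q^a; q^b)_n`. -/
noncomputable def qp (a b n : ℕ) : R⟦X⟧ := ∏ j ∈ range n, (1 - X ^ (a + b * j))

/-- `(q^a; q^b)_∞`. -/
noncomputable def qpInf (a b : ℕ) : R⟦X⟧ := PowerSeries.mk fun N => coeff N (qp R a b (N + 1))

variable {R}

theorem qp_succ (a b n : ℕ) : qp R a b (n + 1) = qp R a b n * (1 - X ^ (a + b * n)) :=
  prod_range_succ _ _

theorem qp_zero (a b : ℕ) : qp R a b 0 = 1 := rfl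

theorem seriesLim_qp (a : ℕ) {b : ℕ} (hb : 1 ≤ b) : SeriesLim (qp R a b) (qpInf R a b) := by
  refine exists_seriesLim fun k => ⟨- (X ^ (a + (b - 1) * k) * qp R a b k), ?_⟩
  obtain ⟨b, rfl⟩ := Nat.exists_eq_add_of_le' hb
  rw [qp_succ, Nat.add_sub_cancel]
  ring

theorem constantCoeff_qp {a : ℕ} (ha : 1 ≤ a) (b n : ℕ) : constantCoeff (qp R a b n) = 1 := by
  have : a ≠ 0 := by omega
  simp [qp, map_prod, this]

theorem constantCoeff_qpInf {a : ℕ} (ha : 1 ≤ a) (b : ℕ) : constantCoeff (qpInf R a b) = 1 := by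
  rw [← coeff_zero_eq_constantCoeff_apply, qpInf, coeff_mk, coeff_zero_eq_constantCoeff_apply,
    constantCoeff_qp ha]

theorem qp_add (a b m n : ℕ) : qp R a b (m + n) = qp R a b m * qp R (a + b * m) b n := by
  rw [qp, prod_range_add, qp, qp]
  congr 1
  exact prod_congr rfl fun j _ => by ring_nf

theorem qpInf_eq_mul' (a : ℕ) {b : ℕ} (hb : 1 ≤ b) (m : ℕ) :
    qpInf R a b = qp R a b m * qpInf R (a + b * m) b :=
  ((seriesLim_qp a hb).comp (φ := fun k => m + k)
      (by simpa [add_comm] using tendsto_shift m)).unique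
    (((SeriesLim.const _).mul (seriesLim_qp _ hb)).congr
      (Eventually.of_forall fun k => (qp_add a b m k).symm))

theorem qp_even_odd (n : ℕ) : qp R 1 1 (2 * n) = qp R 1 2 n * qp R 2 2 n := by
  induction n with
  | zero => simp [qp_zero]
  | succ n ih =>
    rw [show 2 * (n + 1) = 2 * n + 1 + 1 by ring, qp_succ, qp_succ, ih, qp_succ, qp_succ]
    ring

theorem qpInf_even_odd : qpInf R 1 1 = qpInf R 1 2 * qpInf R 2 2 :=
  ((seriesLim_qp 1 le_rfl).comp tendsto_two_mul).unique
    (((seriesLim_qp 1 one_le_two).mul (seriesLim_qp 2 one_le_two)).congr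
      (Eventually.of_forall fun k => (qp_even_odd k).symm))

variable (R) in
/-- `1 / (q; q)_n`. -/
noncomputable def qr (n : ℕ) : R⟦X⟧ := invOfUnit (qp R 1 1 n) 1

theorem qp_mul_qr (n : ℕ) : qp R 1 1 n * qr R n = 1 :=
  mul_invOfUnit _ _ (by simp [constantCoeff_qp])

theorem qr_eq (n : ℕ) : qr R n = (1 - X ^ (n + 1)) * qr R (n + 1) := by
  have h1 := qp_mul_qr (R := R) n
  have h2 := qp_mul_qr (R := R) (n + 1)
  rw [qp_succ, one_mul, add_comm 1 n] at h2
  linear_combination (-qr R n) * h2 + ((1 - X ^ (n + 1)) * qr R (n + 1)) * h1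

theorem qr_zero : qr R 0 = 1 := by simpa [qp_zero] using qp_mul_qr (R := R) 0

end Products

/-! ### Bailey-type expansion of `(z, 1/z; q)_n / (q; q)_{2n}` -/

section BaileyPair

variable {R : Type*} [CommRing R]

variable (R) in
/-- `1 / ((q; q)_{n-r} (q; q)_{n+r})`, zero for `r > n`. -/
noncomputable def qrSymm (n r : ℕ) : R⟦X⟧ := if r ≤ n then qr R (n - r) * qr R (n + r) else 0

variable (R) in
/-- `1 / ((q; q)_{n-r} (q; q)_{n+r+1})`, zero for `r > n`. -/
noncomputable def qrOdd (n r : ℕ) : R⟦X⟧ := if r ≤ n then qr R (n - r) * qr R (n + r + 1) else 0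

theorem qrOdd_of_lt {n r : ℕ} (h : n < r) : qrOdd R n r = 0 := if_neg (by omega)

theorem qrSymm_of_lt {n r : ℕ} (h : n < r) : qrSymm R n r = 0 := if_neg (by omega)

theorem qrOdd_add (r m : ℕ) : qrOdd R (r + m) r = qr R m * qr R (2 * r + m + 1) := by
  rw [qrOdd, if_pos (by omega)]
  congr 2 <;> omega

theorem qrSymm_add (r m : ℕ) : qrSymm R (r + m) r = qr R m * qr R (2 * r + m) := by
  rw [qrSymm, if_pos (by omega)]
  congr 2 <;> omega

theorem qrSymm_eq_qrOdd (r m : ℕ) :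
    qrSymm R (r + m) r = (1 - X ^ (2 * r + m + 1)) * qrOdd R (r + m) r := by
  rw [qrSymm_add, qrOdd_add, qr_eq (2 * r + m)]
  ring

theorem qrSymm_succ_eq_qrOdd (r m : ℕ) :
    qrSymm R (r + m) (r + 1) = (1 - X ^ m) * qrOdd R (r + m) r := by
  rcases m with _ | m
  · rw [qrSymm_of_lt (by omega)]; simp
  · rw [show r + (m + 1) = (r + 1) + m by ring, qrSymm_add, show r + 1 + m = r + (m + 1) by ring,
      qrOdd_add, qr_eq m]
    ring_nf

/-- For `n ≥ r`, the symmetric kernels at `r` and `r + 1` are `1 - q^{n+r+1}` and `1 - q^{n-r}`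
times the odd one, so in this combination the powers depending on `n` cancel. It serves A1; the
companion below, which absorbs the extra `q^n`, serves A3 and E4. -/
theorem one_sub_mul_qrOdd (n r : ℕ) :
    (1 - X ^ (2 * r + 1)) * qrOdd R n r
      = qrSymm R n r - X ^ (2 * r + 1) * qrSymm R n (r + 1) := by
  rcases lt_or_ge n r with h | h
  · rw [qrOdd_of_lt h, qrSymm_of_lt h, qrSymm_of_lt (by omega)]; ring
  · obtain ⟨m, rfl⟩ := Nat.exists_eq_add_of_le h
    rw [qrSymm_eq_qrOdd, qrSymm_succ_eq_qrOdd]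
    ring

theorem X_pow_mul_qrSymm_sub (n r : ℕ) :
    X ^ n * ((1 - X ^ (2 * r + 1)) * qrOdd R n r)
      = X ^ r * (qrSymm R n r - qrSymm R n (r + 1)) := by
  rcases lt_or_ge n r with h | h
  · rw [qrOdd_of_lt h, qrSymm_of_lt h, qrSymm_of_lt (by omega)]; ring
  · obtain ⟨m, rfl⟩ := Nat.exists_eq_add_of_le h
    rw [qrSymm_eq_qrOdd, qrSymm_succ_eq_qrOdd]
    ring

variable (R) in
/-- The coefficients `(-1)^r q^{r(r-1)/2} (1 - q^{2r+1}) / ((q; q)_{n-r} (q; q)_{n+r+1})`. -/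
noncomputable def baileyCoeff (n r : ℕ) : R⟦X⟧ :=
  (-1) ^ r * X ^ (r.choose 2) * ((1 - X ^ (2 * r + 1)) * qrOdd R n r)

theorem baileyCoeff_of_lt {n r : ℕ} (h : n < r) : baileyCoeff R n r = 0 := by
  rw [baileyCoeff, qrOdd_of_lt h]; ring

theorem qrOdd_succ_left (s m : ℕ) :
    qrOdd R (s + m) (s + 1) = (1 - X ^ m) * (1 - X ^ (2 * s + m + 3)) *
      qrOdd R (s + m + 1) (s + 1) := by
  rcases m with _ | m
  · rw [qrOdd_of_lt (by omega)]; simp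
  · rw [show s + (m + 1) = (s + 1) + m by ring, qrOdd_add, add_assoc (s + 1) m 1, qrOdd_add,
      qr_eq m, qr_eq (2 * (s + 1) + m + 1)]
    ring_nf

theorem qrOdd_pred (s m : ℕ) :
    qrOdd R (s + m) s = (1 - X ^ (2 * s + m + 2)) * (1 - X ^ (2 * s + m + 3)) *
      qrOdd R (s + m + 1) (s + 1) := by
  rw [show s + m + 1 = (s + 1) + m by ring, qrOdd_add, qrOdd_add, qr_eq (2 * s + m + 1),
    qr_eq (2 * s + m + 2)]
  ring_nf

/-- The factor `X` avoids the exponent `m - 1`, which would be negative at `m = 0`. -/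
theorem qrOdd_succ_succ (s m : ℕ) :
    X * qrOdd R (s + m) (s + 2) = (1 - X ^ m) * (X - X ^ m) *
      qrOdd R (s + m + 1) (s + 1) := by
  rcases m with _ | _ | m
  · rw [qrOdd_of_lt (by omega)]; simp
  · rw [qrOdd_of_lt (by omega)]; simp
  · rw [show s + (m + 1 + 1) = (s + 2) + m by ring, qrOdd_add, show s + 2 + m + 1 = (s + 1) + (m + 2) by ring, qrOdd_add,
      qr_eq m, qr_eq (m + 1)]
    ring_nf

theorem choose_two_succ (s : ℕ) : (s + 1).choose 2 = s.choose 2 + s := by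
  rw [Nat.choose_succ_succ, Nat.choose_one_right, add_comm]

/-- The effect on the coefficient of `A_{s+1}` of multiplying by `(1 - z q^n)(1 - q^n / z) = 1 - t
q^n + q^{2n}`, given `t A_r = A_{r-1} + A_{r+1}`. -/
theorem baileyCoeff_rec (n s : ℕ) (h : s ≤ n) :
    (1 + X ^ (2 * n)) * baileyCoeff R n (s + 1)
        - X ^ n * (baileyCoeff R n s + baileyCoeff R n (s + 2))
      = (1 - X ^ (2 * n + 1)) * (1 - X ^ (2 * n + 2)) * baileyCoeff R (n + 1) (s + 1) := by
  obtain ⟨m, rfl⟩ := Nat.exists_eq_add_of_le h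
  have h2 := qrOdd_succ_succ (R := R) s m
  simp only [baileyCoeff, choose_two_succ, show s + 2 = s + 1 + 1 from rfl] at h2 ⊢
  rw [qrOdd_succ_left, qrOdd_pred]
  linear_combination (-(X ^ (s + m) * (-1) ^ s * X ^ (s.choose 2) * X ^ (2 * s) *
    (1 - X ^ (2 * (s + 2) + 1)))) * h2

/-- The boundary case: `t A_0 = A_0 + A_1`, as though `A_{-1} = A_0`, so the coefficient at 0
replaces the one at -1. -/
theorem baileyCoeff_rec_zero (n : ℕ) :
    (1 + X ^ (2 * n)) * baileyCoeff R n 0 - X ^ n * (baileyCoeff R n 0 + baileyCoeff R n 1)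
      = (1 - X ^ (2 * n + 1)) * (1 - X ^ (2 * n + 2)) * baileyCoeff R (n + 1) 0 := by
  have e : qrOdd R n 0 = (1 - X ^ (n + 1)) * (1 - X ^ (n + 2)) * qrOdd R (n + 1) 0 := by
    simp only [qrOdd, if_pos (Nat.zero_le _), Nat.sub_zero, add_zero]
    rw [qr_eq n, qr_eq (n + 1)]
    ring
  have e1 : qrOdd R n 1 = (1 - X ^ n) * (1 - X ^ (n + 1)) * qrOdd R (n + 1) 0 := by
    rcases n with _ | n
    · rw [qrOdd_of_lt (by omega)]; simp
    · simp only [qrOdd, if_pos (Nat.zero_le _), Nat.sub_zero, add_zero, Nat.add_sub_cancel,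
        if_pos (Nat.le_add_left 1 n)]
      rw [qr_eq n, qr_eq (n + 1)]
      ring_nf
  simp only [baileyCoeff, e, e1]
  norm_num
  ring

theorem sum_rec_mul {t : R⟦X⟧} {A : ℕ → R⟦X⟧} (h0 : A 0 = 1) (h1 : A 1 = t - 1)
    (hA : ∀ r, A (r + 2) = t * A (r + 1) - A r) (c : ℕ → R⟦X⟧) (k : ℕ) :
    ∑ r ∈ range (k + 1), t * A r * c r
      = A 0 * (c 0 + c 1) + ∑ r ∈ range (k + 1), A (r + 1) * (c r + c (r + 2))
        - A k * c (k + 1) - A (k + 1) * c (k + 2) := by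
  induction k with
  | zero => simp [h0, h1]; ring
  | succ k ih =>
    rw [sum_range_succ, ih, sum_range_succ _ (k + 1), hA k]
    ring

/-- The expansion of `(z; q)_n (1/z; q)_n / (q; q)_{2n}`, where `t = z + 1/z` and
`A_r = (z^{r+1} + z^{-r}) / (1 + z)`. -/
theorem prod_mul_qr_eq_sum {t : R⟦X⟧} {A : ℕ → R⟦X⟧} (h0 : A 0 = 1) (h1 : A 1 = t - 1)
    (hA : ∀ r, A (r + 2) = t * A (r + 1) - A r) (n : ℕ) :
    (∏ j ∈ range n, (1 - t * X ^ j + X ^ (2 * j))) * qr R (2 * n)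
      = ∑ r ∈ range (n + 1), A r * baileyCoeff R n r := by
  induction n with
  | zero =>
    have := qr_eq (R := R) 0
    simp [h0, baileyCoeff, qrOdd, qr_zero] at this ⊢
    exact this
  | succ n ih =>
    have hr : (1 - X ^ (2 * n + 1)) * (1 - X ^ (2 * n + 2)) * qr R (2 * (n + 1)) = qr R (2 * n) := by
      rw [qr_eq (2 * n), qr_eq (2 * n + 1)]; ring_nf
    have key : (1 - t * X ^ n + X ^ (2 * n)) * ∑ r ∈ range (n + 1), A r * baileyCoeff R n r
        = (1 - X ^ (2 * n + 1)) * (1 - X ^ (2 * n + 2)) *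
          ∑ r ∈ range (n + 1 + 1), A r * baileyCoeff R (n + 1) r := by
      have hs := sum_rec_mul h0 h1 hA (baileyCoeff R n) n
      rw [baileyCoeff_of_lt (Nat.lt_succ_self n), baileyCoeff_of_lt (by omega : n < n + 2)] at hs
      have e1 : ∑ r ∈ range (n + 1), A r * baileyCoeff R n r
          = A 0 * baileyCoeff R n 0 + ∑ r ∈ range (n + 1), A (r + 1) * baileyCoeff R n (r + 1) := by
        rw [add_comm (A 0 * _), ← sum_range_succ' (fun r => A r * baileyCoeff R n r), sum_range_succ _ (n + 1),
          baileyCoeff_of_lt (Nat.lt_succ_self n)]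
        ring
      calc _ = (1 + X ^ (2 * n)) * (∑ r ∈ range (n + 1), A r * baileyCoeff R n r)
            - X ^ n * ∑ r ∈ range (n + 1), t * A r * baileyCoeff R n r := by
            have : ∑ r ∈ range (n + 1), t * A r * baileyCoeff R n r
                = t * ∑ r ∈ range (n + 1), A r * baileyCoeff R n r := by
              rw [mul_sum]; exact sum_congr rfl fun r _ => by ring
            rw [this]; ring
        _ = _ := by
            rw [hs, e1, sum_range_succ' _ (n + 1)]
            have e2 : (1 - X ^ (2 * n + 1)) * (1 - X ^ (2 * n + 2)) *
                ∑ r ∈ range (n + 1), A (r + 1) * baileyCoeff R (n + 1) (r + 1)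
                = (1 + X ^ (2 * n)) * ∑ r ∈ range (n + 1), A (r + 1) * baileyCoeff R n (r + 1)
                  - X ^ n * ∑ r ∈ range (n + 1),
                    A (r + 1) * (baileyCoeff R n r + baileyCoeff R n (r + 2)) := by
              rw [mul_sum, mul_sum, mul_sum, ← sum_sub_distrib]
              refine sum_congr rfl fun r hr => ?_
              linear_combination (-A (r + 1)) *
                baileyCoeff_rec (R := R) n r (by simpa [Nat.lt_succ_iff] using hr)
            linear_combination A 0 * baileyCoeff_rec_zero (R := R) n - e2
    rw [prod_range_succ, mul_comm (∏ j ∈ range n, _), mul_assoc]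
    have hu : IsUnit ((1 - X ^ (2 * n + 1)) * (1 - X ^ (2 * n + 2)) : R⟦X⟧) := by
      rw [PowerSeries.isUnit_iff_constantCoeff]
      simp
    refine hu.mul_left_cancel ?_
    rw [← key, ← ih, ← hr]
    ring

/-- At a primitive cube root of unity. -/
theorem prod_cube_mul_qr (n : ℕ) :
    (if n = 0 then 0 else ∏ j ∈ range n, (1 + X ^ j + X ^ (2 * j))) * qr R (2 * n)
      = -3 * ∑ r ∈ range (n + 1) with r % 3 = 1, baileyCoeff R n r := by
  -- `t = -1` corresponds to z = ω, where `A_r` has period 1, -2, 1.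
  have a := prod_mul_qr_eq_sum (R := R) (t := -1) (A := fun r => if r % 3 = 1 then -2 else 1)
    (by simp) (by norm_num) (fun r => by
      have : r % 3 = 0 ∨ r % 3 = 1 ∨ r % 3 = 2 := by omega
      rcases this with h | h | h
      · simp [h, show (r + 2) % 3 = 2 by omega, show (r + 1) % 3 = 1 by omega]; norm_num
      · simp [h, show (r + 2) % 3 = 0 by omega, show (r + 1) % 3 = 2 by omega]; norm_num
      · simp [h, show (r + 2) % 3 = 1 by omega, show (r + 1) % 3 = 0 by omega]; norm_num) n
  -- `t = 2` corresponds to z = 1; the factor `j = 0` then kills the product for `n ≥ 1`.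
  -- Subtracting this expansion removes precisely the `n = 0` term.
  have b := prod_mul_qr_eq_sum (R := R) (t := 2) (A := fun r => 1)
    (by simp) (by norm_num) (fun r => by norm_num) n
  have c : (∏ j ∈ range n, (1 - 2 * X ^ j + X ^ (2 * j)) : R⟦X⟧) = if n = 0 then 1 else 0 := by
    rcases n with _ | n
    · simp
    · rw [if_neg (by omega)]
      refine prod_eq_zero (mem_range.2 (Nat.succ_pos n)) ?_
      norm_num
  have d : (if n = 0 then 0 else ∏ j ∈ range n, (1 + X ^ j + X ^ (2 * j)) : R⟦X⟧)
      = ∏ j ∈ range n, (1 - (-1) * X ^ j + X ^ (2 * j)) - if n = 0 then 1 else 0 := by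
    rcases n with _ | n
    · simp
    · simp
  rw [d, sub_mul, a, ← c, b, ← sum_sub_distrib, sum_filter, mul_sum]
  refine sum_congr rfl fun r _ => ?_
  split_ifs <;> ring

end BaileyPair

/-! ### Series missing a residue class of exponents modulo 3 -/

section Avoids

variable {R : Type*} [CommRing R]

/-- No exponent congruent to `a` modulo `3` occurs in `f`. -/
def Avoids (a : ℕ) (f : R⟦X⟧) : Prop := ∀ N, N % 3 = a → coeff N f = 0

theorem Avoids.sub {a : ℕ} {f g : R⟦X⟧} (hf : Avoids a f) (hg : Avoids a g) : Avoids a (f - g) :=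
  fun N h => by rw [map_sub, hf N h, hg N h, sub_zero]

theorem Avoids.add {a : ℕ} {f g : R⟦X⟧} (hf : Avoids a f) (hg : Avoids a g) : Avoids a (f + g) :=
  fun N h => by rw [map_add, hf N h, hg N h, add_zero]

theorem Avoids.C_mul {a : ℕ} {f : R⟦X⟧} (c : R) (hf : Avoids a f) : Avoids a (C c * f) :=
  fun N h => by rw [coeff_C_mul, hf N h, mul_zero]

theorem Avoids.neg_one_pow_mul {a : ℕ} {f : R⟦X⟧} (r : ℕ) (hf : Avoids a f) :
    Avoids a ((-1) ^ r * f) := by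
  have h := hf.C_mul ((-1) ^ r)
  rwa [map_pow, map_neg, map_one] at h

theorem Avoids.X_pow_mul {a b : ℕ} {f : R⟦X⟧} (hf : Avoids b f) (k : ℕ) (h : (b + k) % 3 = a)
    (hb : b < 3 := by norm_num) : Avoids a (X ^ k * f) := by
  intro N hN
  rw [coeff_X_pow_mul']
  split_ifs with hk
  · exact hf _ (by omega)
  · rfl

theorem avoids_X_pow {a k : ℕ} (h : k % 3 ≠ a) : Avoids a (X ^ k : R⟦X⟧) := by
  intro N hN
  rw [coeff_X_pow, if_neg (by rintro rfl; exact h hN)]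

theorem Avoids.isum {a : ℕ} {f : ℕ → R⟦X⟧} (h : ∀ n, Avoids a (X ^ n * f n)) :
    Avoids a (isum f) := by
  intro N hN
  rw [SptCrank.isum, coeff_mk]
  exact sum_eq_zero fun n _ => h n N hN

theorem choose_two_mod_three {r : ℕ} (h : r % 3 = 1) : r.choose 2 % 3 = 0 := by
  obtain ⟨m, rfl⟩ : ∃ m, r = 3 * m + 1 := ⟨r / 3, by omega⟩
  have : (3 * m + 1).choose 2 = 3 * ((3 * m + 1) * m / 2) := by
    rw [Nat.choose_two_right, Nat.add_sub_cancel]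
    have h2 : 2 ∣ (3 * m + 1) * m := by
      rcases Nat.even_or_odd' m with ⟨k, rfl | rfl⟩
      · exact ⟨(3 * (2 * k) + 1) * k, by ring⟩
      · exact ⟨(3 * k + 2) * (2 * k + 1), by ring⟩
    obtain ⟨k, hk⟩ := h2
    rw [show (3 * m + 1) * (3 * m) = 3 * ((3 * m + 1) * m) by ring, hk]
    omega
  omega

/-- Interchanges the sums over `n` and `r`. Only `n ≤ N` matters for the coefficient of `q^N`, so
everything is finite once the range of `r` is extended to a common bound by zero terms. -/
theorem avoids_of_bailey (K : R⟦X⟧) (d : ℕ → R⟦X⟧) (a : ℕ) (ha : a < 3)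
    (h : ∀ r, r % 3 = 1 →
      Avoids a (K * isum fun n => d n * ((1 - X ^ (2 * r + 1)) * qrOdd R n r))) :
    Avoids a (K * isum fun n =>
      (if n = 0 then 0 else ∏ j ∈ range n, (1 + X ^ j + X ^ (2 * j))) * qr R (2 * n) * d n) := by
  intro N hN
  have e : ∀ n ∈ range (N + 1), X ^ n * (K * ((if n = 0 then 0 else
        ∏ j ∈ range n, (1 + X ^ j + X ^ (2 * j))) * qr R (2 * n) * d n))
      = ∑ r ∈ range (N + 1) with r % 3 = 1,
        C (-3 : R) * (X ^ n * (K * (d n * baileyCoeff R n r))) := by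
    intro n hn
    rw [prod_cube_mul_qr, sum_subset (filter_subset_filter _
      (range_subset_range.2 (by simpa using hn : n + 1 ≤ N + 1)))]
    · rw [mul_sum, sum_mul, mul_sum, mul_sum]
      refine sum_congr rfl fun r _ => ?_
      simp only [map_neg, map_ofNat]
      ring
    · intro r hr hr'
      simp only [mem_filter, mem_range] at hr hr'
      exact baileyCoeff_of_lt (by omega)
  rw [mul_isum, isum, coeff_mk, sum_congr rfl fun n hn => by rw [e n hn, map_sum], sum_comm]
  refine sum_eq_zero fun r hr => ?_
  have hr' := (mem_filter.1 hr).2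
  -- The power `q^{r(r-1)/2}` shifts exponents by a multiple of 3, so the avoided class is
  -- unchanged.
  have h1 := ((((h r hr').X_pow_mul (r.choose 2)
    (by have := choose_two_mod_three hr'; omega : _ = a) ha).neg_one_pow_mul r).C_mul (-3)) N hN
  rw [mul_isum, mul_isum, mul_isum, mul_isum, isum, coeff_mk] at h1
  rw [← h1]
  refine sum_congr rfl fun n _ => ?_
  rw [baileyCoeff]
  congr 1
  ring

end Avoids

/-! ### Telescoping sums and partial theta recurrences: A1, A3, E4 -/

section ConjugateBailey

variable {R : Type*} [CommRing R]

variable (R) in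
/-- `1 / ((q; q)_{n-r-1} (q; q)_{n+r})`, zero for `n ≤ r`. -/
noncomputable def qrLag (n r : ℕ) : R⟦X⟧ := if r < n then qr R (n - r - 1) * qr R (n + r) else 0

theorem qrLag_succ (n r : ℕ) : qrLag R (n + 1) r = qrOdd R n r := by
  rw [qrLag, qrOdd]
  simp only [Nat.lt_succ_iff]
  split_ifs with h
  · congr 2 <;> omega
  · rfl

theorem qrLag_add (r m : ℕ) :
    qrLag R (r + m) r = (1 - X ^ m) * (1 - X ^ (2 * r + m + 1)) * qrOdd R (r + m) r := by
  rcases m with _ | m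
  · simp [qrLag]
  · rw [← add_assoc, qrLag_succ, qrOdd_add, add_assoc r m 1, qrOdd_add, qr_eq m, qr_eq (2 * r + m + 1)]
    ring_nf

theorem qrLag_of_le {n r : ℕ} (h : n ≤ r) : qrLag R n r = 0 := if_neg (by omega)

theorem isUnit_of_constantCoeff {f : R⟦X⟧} (h : constantCoeff f = 1) : IsUnit f := by
  rw [isUnit_iff_constantCoeff, h]
  exact isUnit_one

theorem isUnit_qpInf {a : ℕ} (ha : 1 ≤ a) (b : ℕ) : IsUnit (qpInf R a b) :=
  isUnit_of_constantCoeff (constantCoeff_qpInf ha b)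

/-- If the partial sums of a series are `T n / ((q; q)_{n-r-1} (q; q)_{n+r})`, then its sum is
`lim T / (q; q)_∞²`. -/
theorem qpInf_sq_mul_isum {f T : ℕ → R⟦X⟧} {L : R⟦X⟧} (r : ℕ)
    (h : ∀ n, X ^ n * f n = T (n + 1) * qrLag R (n + 1) r - T n * qrLag R n r)
    (hT : SeriesLim T L) : qpInf R 1 1 ^ 2 * isum f = L := by
  have h1 := seriesLim_of_telescope (T := fun n => T n * qrLag R n r) h
    (by simp [qrLag_of_le])
  have h2 := (((seriesLim_qp (R := R) 1 le_rfl).comp (tendsto_sub_atTop (r + 1))).mul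
    ((seriesLim_qp (R := R) 1 le_rfl).comp (tendsto_shift r))).mul h1
  rw [sq]
  refine (h2.congr ?_).unique hT
  filter_upwards [eventually_gt_atTop r] with k hk
  rw [qrLag, if_pos hk, show k - (r + 1) = k - r - 1 by omega]
  linear_combination (T k * qr R (k + r) * qp R 1 1 (k + r)) * qp_mul_qr (R := R) (k - r - 1)
    + T k * qp_mul_qr (R := R) (k + r)

variable (R) in
/-- `(q; q)_∞² ∑_n q^n / ((q; q)_{n-r} (q; q)_{n+r})`. -/
noncomputable def partialThetaA (r : ℕ) : R⟦X⟧ := qpInf R 1 1 ^ 2 * isum fun n => qrSymm R n r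

/-- The coefficient `q^{4r+2}` is chosen so that the combined summand telescopes with a numerator
independent of `n`. -/
theorem partialThetaA_rec (r : ℕ) :
    partialThetaA R r = X ^ r - X ^ (3 * r + 1) + X ^ (4 * r + 2) * partialThetaA R (r + 1) := by
  have h := qpInf_sq_mul_isum (R := R) r
    (f := fun n => qrSymm R n r - X ^ (4 * r + 2) * qrSymm R n (r + 1))
    (T := fun _ => X ^ r * (1 - X ^ (2 * r + 1))) (fun n => ?_) (SeriesLim.const _)
  · rw [isum_sub, ← mul_isum] at h
    simp only [partialThetaA]
    linear_combination h
  · rw [qrLag_succ]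
    rcases lt_or_ge n r with hn | hn
    · rw [qrOdd_of_lt hn, qrSymm_of_lt hn, qrSymm_of_lt (by omega), qrLag_of_le hn.le]; ring
    · obtain ⟨m, rfl⟩ := Nat.exists_eq_add_of_le hn
      rw [qrSymm_eq_qrOdd, qrSymm_succ_eq_qrOdd, qrLag_add]
      ring

/-- The two claims must be proved together: `r ≡ 2` steps to `r + 1 ≡ 0`, where the shift `4r + 2 ≡
1` turns class 0 into class 2, and `r ≡ 0` steps back to class 0 at `r + 1 ≡ 1`. The shift is
positive, so induction on the exponent terminates. -/
theorem partialThetaA_avoids_aux (N : ℕ) : ∀ r,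
    (r % 3 ≠ 0 → N % 3 = 0 → coeff N (partialThetaA R r) = 0) ∧
    (r % 3 = 0 → N % 3 = 2 → coeff N (partialThetaA R r) = 0) := by
  induction N using Nat.strong_induction_on with
  | _ N ih =>
    intro r
    constructor
    · intro hr hN
      rw [partialThetaA_rec, map_add, map_sub, coeff_X_pow, coeff_X_pow, if_neg (by omega),
        if_neg (by omega), coeff_X_pow_mul']
      split_ifs with h
      · rcases (by omega : r % 3 = 1 ∨ r % 3 = 2) with h1 | h1
        · rw [(ih _ (by omega) (r + 1)).1 (by omega) (by omega)]; ring
        · rw [(ih _ (by omega) (r + 1)).2 (by omega) (by omega)]; ring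
      · ring
    · intro hr hN
      rw [partialThetaA_rec, map_add, map_sub, coeff_X_pow, coeff_X_pow, if_neg (by omega),
        if_neg (by omega), coeff_X_pow_mul']
      split_ifs with h
      · rw [(ih _ (by omega) (r + 1)).1 (by omega) (by omega)]; ring
      · ring

theorem partialThetaA_avoids {r : ℕ} (hr : r % 3 ≠ 0) : Avoids 0 (partialThetaA R r) :=
  fun N hN => (partialThetaA_avoids_aux N r).1 hr hN

variable (R) in
/-- `(q; q)_∞ (q²; q²)_∞ ∑_n (q; q²)_n q^n / ((q; q)_{n-r} (q; q)_{n+r})`. -/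
noncomputable def partialThetaE (r : ℕ) : R⟦X⟧ :=
  qpInf R 1 1 * qpInf R 2 2 * isum fun n => qp R 1 2 n * qrSymm R n r

/-- Here the telescoping numerator is `q^r (q; q²)_n`. Its limit times `(q²; q²)_∞` is `q^r (q;
q)_∞`, and one factor `(q; q)_∞` cancels. -/
theorem partialThetaE_rec (r : ℕ) :
    partialThetaE R r = X ^ r - X ^ (2 * r + 1) * partialThetaE R (r + 1) := by
  have h := qpInf_sq_mul_isum (R := R) r
    (f := fun n => qp R 1 2 n * qrSymm R n r + X ^ (2 * r + 1) * (qp R 1 2 n * qrSymm R n (r + 1)))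
    (T := fun n => X ^ r * qp R 1 2 n) (fun n => ?_)
    ((SeriesLim.const _).mul (seriesLim_qp 1 one_le_two))
  · rw [isum_add, ← mul_isum] at h
    simp only [partialThetaE]
    refine (isUnit_qpInf le_rfl 1).mul_left_cancel ?_
    linear_combination qpInf R 2 2 * h - X ^ r * qpInf_even_odd (R := R)
  · rw [qrLag_succ, qp_succ]
    rcases lt_or_ge n r with hn | hn
    · rw [qrOdd_of_lt hn, qrSymm_of_lt hn, qrSymm_of_lt (by omega), qrLag_of_le hn.le]; ring
    · obtain ⟨m, rfl⟩ := Nat.exists_eq_add_of_le hn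
      rw [qrSymm_eq_qrOdd, qrSymm_succ_eq_qrOdd, qrLag_add]
      ring

theorem partialThetaE_avoids_aux (N : ℕ) : ∀ r,
    (r % 3 ≠ 0 → N % 3 = 0 → coeff N (partialThetaE R r) = 0) ∧
    (r % 3 = 0 → N % 3 = 1 → coeff N (partialThetaE R r) = 0) := by
  induction N using Nat.strong_induction_on with
  | _ N ih =>
    intro r
    constructor
    · intro hr hN
      rw [partialThetaE_rec, map_sub, coeff_X_pow, if_neg (by omega), coeff_X_pow_mul']
      split_ifs with h
      · rcases (by omega : r % 3 = 1 ∨ r % 3 = 2) with h1 | h1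
        · rw [(ih _ (by omega) (r + 1)).1 (by omega) (by omega)]; ring
        · rw [(ih _ (by omega) (r + 1)).2 (by omega) (by omega)]; ring
      · ring
    · intro hr hN
      rw [partialThetaE_rec, map_sub, coeff_X_pow, if_neg (by omega), coeff_X_pow_mul']
      split_ifs with h
      · rw [(ih _ (by omega) (r + 1)).1 (by omega) (by omega)]; ring
      · ring

theorem partialThetaE_avoids {r : ℕ} (hr : r % 3 ≠ 0) : Avoids 0 (partialThetaE R r) :=
  fun N hN => (partialThetaE_avoids_aux N r).1 hr hN

theorem avoids_A1 {r : ℕ} (hr : r % 3 = 1) : Avoids 0 (qpInf R 1 1 * qpInf R 1 1 *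
    isum fun n => 1 * ((1 - X ^ (2 * r + 1)) * qrOdd R n r)) := by
  have e : qpInf R 1 1 * qpInf R 1 1 * (isum fun n => 1 * ((1 - X ^ (2 * r + 1)) * qrOdd R n r))
      = partialThetaA R r - X ^ (2 * r + 1) * partialThetaA R (r + 1) := by
    simp only [one_mul, one_sub_mul_qrOdd, isum_sub, ← mul_isum, partialThetaA]
    ring
  rw [e]
  exact (partialThetaA_avoids (by omega)).sub
    ((partialThetaA_avoids (by omega)).X_pow_mul _ (by omega))

theorem avoids_A3 {r : ℕ} (hr : r % 3 = 1) : Avoids 1 (qpInf R 1 1 * qpInf R 1 1 *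
    isum fun n => X ^ n * ((1 - X ^ (2 * r + 1)) * qrOdd R n r)) := by
  have e : qpInf R 1 1 * qpInf R 1 1 * (isum fun n => X ^ n * ((1 - X ^ (2 * r + 1)) * qrOdd R n r))
      = X ^ r * (partialThetaA R r - partialThetaA R (r + 1)) := by
    simp only [X_pow_mul_qrSymm_sub, isum_sub, ← mul_isum, partialThetaA]
    ring
  rw [e]
  exact ((partialThetaA_avoids (by omega)).sub
    (partialThetaA_avoids (by omega))).X_pow_mul _ (by omega)

theorem avoids_E4 {r : ℕ} (hr : r % 3 = 1) : Avoids 1 (qpInf R 1 1 * qpInf R 2 2 *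
    isum fun n => X ^ n * qp R 1 2 n * ((1 - X ^ (2 * r + 1)) * qrOdd R n r)) := by
  have e : qpInf R 1 1 * qpInf R 2 2 *
      (isum fun n => X ^ n * qp R 1 2 n * ((1 - X ^ (2 * r + 1)) * qrOdd R n r))
      = X ^ r * (partialThetaE R r - partialThetaE R (r + 1)) := by
    have (n : ℕ) : X ^ n * qp R 1 2 n * ((1 - X ^ (2 * r + 1)) * qrOdd R n r)
        = X ^ r * (qp R 1 2 n * qrSymm R n r - qp R 1 2 n * qrSymm R n (r + 1)) := by
      linear_combination qp R 1 2 n * X_pow_mul_qrSymm_sub (R := R) n r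
    simp only [this, ← mul_isum, isum_sub, partialThetaE]
    ring
  rw [e]
  exact ((partialThetaE_avoids (by omega)).sub
    (partialThetaE_avoids (by omega))).X_pow_mul _ (by omega)

end ConjugateBailey

/-! ### Gauss's product for `∑ (-1)^n q^{n²}` -/

section Theta

variable {R : Type*} [CommRing R]

variable (R) in
/-- `1 / (q²; q²)_n`. -/
noncomputable def qrEven (n : ℕ) : R⟦X⟧ := invOfUnit (qp R 2 2 n) 1

theorem qp_mul_qrEven (n : ℕ) : qp R 2 2 n * qrEven R n = 1 :=
  mul_invOfUnit _ _ (by simp [constantCoeff_qp])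

theorem qrEven_eq (n : ℕ) : qrEven R n = (1 - X ^ (2 * n + 2)) * qrEven R (n + 1) := by
  have h1 := qp_mul_qrEven (R := R) n
  have h2 := qp_mul_qrEven (R := R) (n + 1)
  rw [qp_succ, add_comm 2 (2 * n)] at h2
  linear_combination (-qrEven R n) * h2 + ((1 - X ^ (2 * n + 2)) * qrEven R (n + 1)) * h1

theorem qrEven_zero : qrEven R 0 = 1 := by simpa [qp_zero] using qp_mul_qrEven (R := R) 0

variable (R) in
/-- `(-1)^j q^{j²} / ((q²; q²)_{n-j} (q²; q²)_{n+j})`, zero for `j > n`. -/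
noncomputable def thetaCoeff (n j : ℕ) : R⟦X⟧ :=
  if j ≤ n then (-1) ^ j * X ^ (j ^ 2) * (qrEven R (n - j) * qrEven R (n + j)) else 0

theorem thetaCoeff_of_lt {n j : ℕ} (h : n < j) : thetaCoeff R n j = 0 := if_neg (by omega)

theorem thetaCoeff_add (j m : ℕ) : thetaCoeff R (j + m) j
    = (-1) ^ j * X ^ (j ^ 2) * (qrEven R m * qrEven R (2 * j + m)) := by
  rw [thetaCoeff, if_pos (by omega)]
  congr 3 <;> omega

/-- The coefficient recurrence for multiplying `∑ c_j z^j` by `(1 - z q^{2n+1})(1 - q^{2n+1} / z)`,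
as in the finite Jacobi triple product. -/
theorem thetaCoeff_rec (n s : ℕ) (h : s ≤ n) :
    (1 + X ^ (4 * n + 2)) * thetaCoeff R n (s + 1)
        - X ^ (2 * n + 1) * (thetaCoeff R n s + thetaCoeff R n (s + 2))
      = (1 - X ^ (4 * n + 2)) * (1 - X ^ (4 * n + 4)) * thetaCoeff R (n + 1) (s + 1) := by
  obtain ⟨m, rfl⟩ := Nat.exists_eq_add_of_le h
  rw [show s + m + 1 = (s + 1) + m by ring, thetaCoeff_add s, thetaCoeff_add (s + 1),
    qrEven_eq (2 * s + m), qrEven_eq (2 * s + m + 1),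
    show 2 * (s + 1) + m = 2 * s + m + 1 + 1 by ring]
  rcases m with _ | _ | m
  · rw [thetaCoeff_of_lt (by omega), thetaCoeff_of_lt (by omega)]
    ring
  · rw [zero_add, show thetaCoeff R (s + 1) (s + 1) = _ from thetaCoeff_add (s + 1) 0,
      thetaCoeff_of_lt (by omega), qrEven_eq 0, zero_add,
      show 2 * (s + 1) + 0 = 2 * s + 1 + 1 by ring, qrEven_eq (2 * s + 1 + 1)]
    ring
  · rw [show s + (m + 1 + 1) = (s + 1) + (m + 1) by ring, thetaCoeff_add,
      show s + 1 + (m + 1) = (s + 2) + m by ring, thetaCoeff_add, qrEven_eq m, qrEven_eq (m + 1),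
      show 2 * (s + 1) + (m + 1) = 2 * s + (m + 1 + 1) + 1 by ring,
      show 2 * (s + 2) + m = 2 * s + (m + 1 + 1) + 1 + 1 by ring,
      qrEven_eq (2 * s + (m + 1 + 1) + 1)]
    ring

theorem thetaCoeff_rec_zero (n : ℕ) :
    (1 + X ^ (4 * n + 2)) * thetaCoeff R n 0 - 2 * X ^ (2 * n + 1) * thetaCoeff R n 1
      = (1 - X ^ (4 * n + 2)) * (1 - X ^ (4 * n + 4)) * thetaCoeff R (n + 1) 0 := by
  have e (n : ℕ) : thetaCoeff R n 0 = qrEven R n * qrEven R n := by simp [thetaCoeff]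
  rcases n with _ | n
  · rw [e, e, thetaCoeff_of_lt (by omega), qrEven_eq 0]; ring
  · have t : thetaCoeff R (n + 1) 1 = - X * (qrEven R n * qrEven R (n + 1 + 1)) := by
      rw [add_comm n 1, thetaCoeff_add, show 2 * 1 + n = 1 + n + 1 by ring]
      ring
    rw [t, e, e, qrEven_eq n, qrEven_eq (n + 1)]
    ring

/-- The finite triple product at z = 1, with the terms `j` and `-j` combined; letting `n → ∞` yields
`theta_eq`. -/
theorem sum_thetaCoeff (n : ℕ) :
    qp R 1 2 n ^ 2 * qrEven R (2 * n)
      = thetaCoeff R n 0 + 2 * ∑ j ∈ range n, thetaCoeff R n (j + 1) := by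
  induction n with
  | zero => simp [qp_zero, qrEven_zero, thetaCoeff]
  | succ n ih =>
    have hr : (1 - X ^ (4 * n + 2)) * (1 - X ^ (4 * n + 4)) * qrEven R (2 * (n + 1))
        = qrEven R (2 * n) := by
      rw [qrEven_eq (2 * n), qrEven_eq (2 * n + 1)]; ring_nf
    have hu : IsUnit ((1 - X ^ (4 * n + 2)) * (1 - X ^ (4 * n + 4)) : R⟦X⟧) :=
      isUnit_of_constantCoeff (by simp)
    refine hu.mul_left_cancel ?_
    have e2 : (1 - X ^ (4 * n + 2)) * (1 - X ^ (4 * n + 4)) *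
        ∑ j ∈ range (n + 1), thetaCoeff R (n + 1) (j + 1)
        = (1 + X ^ (4 * n + 2)) * (∑ j ∈ range (n + 1), thetaCoeff R n (j + 1))
          - X ^ (2 * n + 1) * ((∑ j ∈ range (n + 1), thetaCoeff R n j)
            + ∑ j ∈ range (n + 1), thetaCoeff R n (j + 2)) := by
      rw [mul_sum, mul_sum, ← sum_add_distrib, mul_sum, ← sum_sub_distrib]
      exact sum_congr rfl fun j hj =>
        (thetaCoeff_rec n j (by simpa [Nat.lt_succ_iff] using hj)).symm
    have s1 := sum_range_succ' (thetaCoeff R n) n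
    have s2 := sum_range_succ (fun j => thetaCoeff R n (j + 1)) n
    have s3 := sum_range_succ' (fun j => thetaCoeff R n (j + 1)) (n + 1)
    have s4 := sum_range_succ (fun j => thetaCoeff R n (j + 1)) (n + 1)
    rw [thetaCoeff_of_lt (by omega : n < n + 1)] at s2
    rw [thetaCoeff_of_lt (by omega : n < n + 1 + 1)] at s4
    rw [s4, zero_add, s2] at s3
    rw [s1, s2] at e2
    have h0 := thetaCoeff_rec_zero (R := R) n
    rw [qp_succ]
    simp only [add_assoc, Nat.reduceAdd] at s3 e2 ⊢
    linear_combination ((1 - X ^ (1 + 2 * n)) ^ 2 * qp R 1 2 n ^ 2) * hr + h0 - 2 * e2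
      + (1 - X ^ (1 + 2 * n)) ^ 2 * ih - 2 * X ^ (2 * n + 1) * s3

variable (R) in
/-- `∑_{n ∈ ℤ} (-1)^n q^{n²}`. -/
noncomputable def theta : R⟦X⟧ :=
  1 + 2 * (X * isum fun j => (-1) ^ (j + 1) * X ^ (j ^ 2 + j))

variable (R) in
/-- `1 / (q²; q²)_∞`. -/
noncomputable def qrEvenInf : R⟦X⟧ := PowerSeries.mk fun N => coeff N (qrEven R (N + 1))

theorem seriesLim_qrEven : SeriesLim (qrEven R) (qrEvenInf R) :=
  exists_seriesLim fun k => ⟨X ^ (k + 2) * qrEven R (k + 1), by rw [qrEven_eq k]; ring⟩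

theorem qpInf_mul_qrEvenInf : qpInf R 2 2 * qrEvenInf R = 1 :=
  (((seriesLim_qp 2 one_le_two).mul seriesLim_qrEven).congr
    (Eventually.of_forall qp_mul_qrEven)).unique (SeriesLim.const 1)

theorem theta_eq : qpInf R 2 2 * qpInf R 1 2 ^ 2 = theta R := by
  have l1 : SeriesLim (fun n => qp R 1 2 n ^ 2 * qrEven R (2 * n))
      (qpInf R 1 2 * qpInf R 1 2 * qrEvenInf R) :=
    (((seriesLim_qp 1 one_le_two).mul (seriesLim_qp 1 one_le_two)).mul
      (seriesLim_qrEven.comp tendsto_two_mul)).congr (Eventually.of_forall fun n => by simp only [sq])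
  let f (n j : ℕ) : R⟦X⟧ := if j + 1 ≤ n then
    (-1) ^ (j + 1) * X ^ (j ^ 2 + j) * (qrEven R (n - (j + 1)) * qrEven R (n + (j + 1))) else 0
  have l2 : SeriesLim (fun n => isum (f n))
      (isum fun j => (-1) ^ (j + 1) * X ^ (j ^ 2 + j) * (qrEvenInf R * qrEvenInf R)) := by
    refine SeriesLim.isum fun j => ?_
    refine ((SeriesLim.const _).mul ((seriesLim_qrEven.comp (tendsto_sub_atTop (j + 1))).mul
      (seriesLim_qrEven.comp (tendsto_shift (j + 1))))).congr ?_
    filter_upwards [eventually_ge_atTop (j + 1)] with n hn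
    simp only [f, if_pos hn]
  have l3 : SeriesLim (fun n => qrEven R n * qrEven R n + 2 * (X * isum (f n)))
      (qrEvenInf R * qrEvenInf R + 2 * (X * isum fun j =>
        (-1) ^ (j + 1) * X ^ (j ^ 2 + j) * (qrEvenInf R * qrEvenInf R))) :=
    (seriesLim_qrEven.mul seriesLim_qrEven).add
      ((SeriesLim.const 2).mul ((SeriesLim.const X).mul l2))
  have e := l1.unique (l3.congr (Eventually.of_forall fun n => ?_))
  · have e3 : (isum fun j => (-1) ^ (j + 1) * X ^ (j ^ 2 + j) * (qrEvenInf R * qrEvenInf R))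
        = (qrEvenInf R * qrEvenInf R) * isum fun j => (-1) ^ (j + 1) * X ^ (j ^ 2 + j) := by
      rw [mul_isum]
      congr 1
      funext j
      ring
    rw [e3] at e
    have h := qpInf_mul_qrEvenInf (R := R)
    set Q := qpInf R 2 2
    set I := qrEvenInf R
    rw [theta]
    have h2 : Q ^ 2 * (I * I) = 1 := by linear_combination (Q * I + 1) * h
    linear_combination Q ^ 2 * e - Q * qpInf R 1 2 ^ 2 * h
      + (1 + 2 * (X * isum fun j => (-1) ^ (j + 1) * X ^ (j ^ 2 + j))) * h2
  · rw [sum_thetaCoeff, isum_eq_sum (K := n) (fun j hj => if_neg (by omega)), mul_sum]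
    congr 1
    · simp [thetaCoeff]
    · congr 1
      refine sum_congr rfl fun j hj => ?_
      have hj' : j + 1 ≤ n := by simpa using hj
      simp only [thetaCoeff, if_pos hj']
      ring

theorem avoids_theta : Avoids 2 (theta R) := by
  have h1 : Avoids 2 (1 : R⟦X⟧) := by simpa using avoids_X_pow (R := R) (a := 2) (k := 0) (by simp)
  have h2 : Avoids 2 (isum fun j => (X : R⟦X⟧) * ((-1) ^ (j + 1) * X ^ (j ^ 2 + j))) := by
    refine Avoids.isum fun j => ?_
    rw [show (X : R⟦X⟧) ^ j * (X * ((-1) ^ (j + 1) * X ^ (j ^ 2 + j)))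
      = (-1) ^ (j + 1) * X ^ ((j + 1) ^ 2) by ring]
    refine (avoids_X_pow ?_).neg_one_pow_mul _
    rw [Nat.pow_mod]
    have : (j + 1) % 3 < 3 := Nat.mod_lt _ (by norm_num)
    interval_cases (j + 1) % 3 <;> simp
  rw [theta, mul_isum]
  refine h1.add ?_
  have h3 := h2.C_mul 2
  rwa [map_ofNat] at h3

end Theta

/-! ### A q-Gauss sum and the case E2 -/

section QGauss

variable {R : Type*} [CommRing R]

variable (R) in
/-- `1 / (q; q)_∞`. -/
noncomputable def qrInf : R⟦X⟧ := PowerSeries.mk fun N => coeff N (qr R (N + 1))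

theorem seriesLim_qr : SeriesLim (qr R) (qrInf R) :=
  exists_seriesLim fun k => ⟨X * qr R (k + 1), by rw [qr_eq k]; ring⟩

theorem qpInf_mul_qrInf : qpInf R 1 1 * qrInf R = 1 :=
  (((seriesLim_qp 1 le_rfl).mul seriesLim_qr).congr
    (Eventually.of_forall qp_mul_qr)).unique (SeriesLim.const 1)

/-- Subtracting the two series produces the factor `1 - q^k`, which lowers `1 / (q; q)_k` to index
`k - 1`; reindexing recovers the original series. -/
theorem isum_euler_succ (m : ℕ) :
    (isum fun k => (-1) ^ k * X ^ ((m + 1) * k) * qr R k)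
      = (1 + X ^ (m + 1)) * isum fun k => (-1) ^ k * X ^ (m * k) * qr R k := by
  have h : (isum fun k => (-1) ^ k * X ^ (m * k) * qr R k)
        - (isum fun k => (-1) ^ k * X ^ ((m + 1) * k) * qr R k)
      = isum fun k => (-1) ^ k * X ^ (m * k) * (1 - X ^ k) * qr R k := by
    rw [← isum_sub]
    congr 1
    funext k
    ring
  have h2 : (isum fun k => (-1) ^ k * X ^ (m * k) * (1 - X ^ k) * qr R k)
      = - X ^ (m + 1) * isum fun k => (-1) ^ k * X ^ (m * k) * qr R k := by
    rw [isum_eq_zero_add, mul_isum, mul_isum]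
    simp only [pow_zero, sub_self, mul_zero, zero_mul, zero_add]
    congr 1
    funext k
    rw [qr_eq k]
    ring
  linear_combination (-1) * h - h2

/-- Euler's `∑_k (-q)^k / (q; q)_k = 1 / (-q; q)_∞`. -/
theorem qpInf_mul_isum_euler : qpInf R 2 2 * (isum fun k => (-1) ^ k * qr R k) = qpInf R 1 1 := by
  have h (M : ℕ) : qp R 2 2 M * (isum fun k => (-1) ^ k * qr R k)
      = qp R 1 1 M * isum fun k => (-1) ^ k * X ^ (M * k) * qr R k := by
    induction M with
    | zero => simp [qp_zero]
    | succ M ih =>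
      rw [qp_succ, qp_succ, isum_euler_succ]
      linear_combination (1 - X ^ (2 + 2 * M)) * ih
  have l : SeriesLim (fun M => isum fun k => (-1) ^ k * X ^ (M * k) * qr R k)
      (isum fun k => if k = 0 then 1 else 0) := by
    refine SeriesLim.isum fun k => ?_
    rcases k with _ | k
    · simpa [qr_zero] using SeriesLim.const (1 : R⟦X⟧)
    · rw [if_neg (by omega)]
      refine (seriesLim_X_pow_mul (fun _ => (-1) ^ (k + 1) * qr R (k + 1))
        (φ := fun M => M * (k + 1)) ?_).congr (Eventually.of_forall fun M => by ring)
      exact tendsto_atTop_mono (fun M => Nat.le_mul_of_pos_right M k.succ_pos) tendsto_id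
  have e : (isum fun k => if k = 0 then 1 else 0 : R⟦X⟧) = 1 := by
    rw [isum_eq_sum (K := 1) (fun n hn => if_neg (by omega))]
    simp
  rw [e] at l
  have := (((seriesLim_qp 2 one_le_two).mul (SeriesLim.const _)).congr
    (Eventually.of_forall h)).unique ((seriesLim_qp 1 le_rfl).mul l)
  rwa [mul_one] at this

variable (R) in
/-- A specialization of the series in the `q`-Gauss sum. -/
noncomputable def gaussSeries (r : ℕ) : R⟦X⟧ :=
  isum fun n => (-1) ^ n * qp R 1 2 n * ((1 - X ^ (2 * r + 1)) * qrOdd R n r)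

/-- The combination of both summands telescopes, and the partial sums carry a factor `q^n`, so they
tend to 0. -/
theorem gaussSeries_succ (r : ℕ) : gaussSeries R (r + 1) = - X * gaussSeries R r := by
  have h := seriesLim_of_telescope (R := R)
    (f := fun n => (-1) ^ n * qp R 1 2 n * ((1 - X ^ (2 * (r + 1) + 1)) * qrOdd R n (r + 1))
      + X * ((-1) ^ n * qp R 1 2 n * ((1 - X ^ (2 * r + 1)) * qrOdd R n r)))
    (T := fun n => X ^ n * (-(1 - X ^ (2 * r + 2)) * (-1) ^ n * qp R 1 2 n *
      qrSymm R n (r + 1))) (fun n => ?_) (by simp [qrSymm])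
  · have h0 := h.unique (seriesLim_X_pow_mul _ tendsto_id)
    rw [isum_add, ← mul_isum] at h0
    rw [gaussSeries, gaussSeries]
    linear_combination h0
  · rcases lt_or_ge n r with hn | hn
    · rw [qrOdd_of_lt hn, qrOdd_of_lt (by omega), qrSymm_of_lt (by omega), qrSymm_of_lt (by omega)]
      ring
    · obtain ⟨m, rfl⟩ := Nat.exists_eq_add_of_le hn
      have e1 : qrSymm R (r + m + 1) (r + 1) = qr R m * qr R (2 * r + m + 2) := by
        rw [show r + m + 1 = (r + 1) + m by ring, qrSymm_add]; ring_nf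
      have e2 : qrOdd R (r + m) (r + 1) = (1 - X ^ m) * (qr R m * qr R (2 * r + m + 2)) := by
        rcases m with _ | m
        · rw [qrOdd_of_lt (by omega)]; simp
        · rw [show r + (m + 1) = (r + 1) + m by ring, qrOdd_add, qr_eq m]; ring_nf
      rw [e1, e2, qrSymm_succ_eq_qrOdd, qrOdd_add, qr_eq (2 * r + m + 1), qp_succ]
      ring

theorem isum_shift {f : ℕ → R⟦X⟧} (r : ℕ) (h : ∀ n < r, f n = 0) :
    isum f = X ^ r * isum fun k => f (k + r) := by
  induction r with
  | zero => simp
  | succ r ih =>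
    rw [ih fun n hn => h n (by omega), isum_eq_zero_add fun k => f (k + r), zero_add,
      h r (by omega), zero_add, pow_succ, mul_assoc]
    simp only [add_assoc, add_comm 1 r]

theorem gaussSeries_eq (r : ℕ) : gaussSeries R r = (-X) ^ r * gaussSeries R 0 := by
  induction r with
  | zero => simp
  | succ r ih => rw [gaussSeries_succ, ih]; ring

/-- Since the series at `r` is `(-q)^r` times the one at 0, the latter has an expression for every
`r`; the value is found by letting `r → ∞` in it. -/
theorem gaussSeries_zero :
    gaussSeries R 0 = qpInf R 1 2 * qrInf R * isum fun k => (-1) ^ k * qr R k := by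
  have h (r : ℕ) : gaussSeries R 0
      = isum fun k => (-1) ^ k * qp R 1 2 (k + r) * ((1 - X ^ (2 * r + 1)) *
        (qr R k * qr R (2 * r + k + 1))) := by
    have h1 := gaussSeries_eq (R := R) r
    rw [gaussSeries, isum_shift r fun n hn => by rw [qrOdd_of_lt hn]; ring, neg_pow,
      mul_comm ((-1) ^ r), mul_assoc] at h1
    -- The terms with `n < r` vanish, so both sides carry `q^r`, which cancels.
    have h2 := X_pow_mul_cancel h1
    have h3 : ((-1) ^ r * (-1) ^ r : R⟦X⟧) = 1 := by rw [← mul_pow]; simp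
    calc gaussSeries R 0 = (-1) ^ r * ((-1) ^ r * gaussSeries R 0) := by
          rw [← mul_assoc, h3, one_mul]
      _ = _ := by
        rw [← h2, mul_isum]
        congr 1
        funext k
        rw [add_comm k r, qrOdd_add, pow_add]
        linear_combination ((-1) ^ k * qp R 1 2 (r + k) * ((1 - X ^ (2 * r + 1)) *
          (qr R k * qr R (2 * r + k + 1)))) * h3
  refine (SeriesLim.const (gaussSeries R 0)).unique ?_
  rw [mul_isum]
  refine (SeriesLim.isum fun k => ?_).congr (Eventually.of_forall fun r => (h r).symm)
  have l1 : SeriesLim (fun r => 1 - X ^ (2 * r + 1) * 1 : ℕ → R⟦X⟧) (1 - 0) :=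
    (SeriesLim.const 1).sub (seriesLim_X_pow_mul _
      (tendsto_atTop_mono (fun r => by show r ≤ 2 * r + 1; omega) tendsto_id))
  have l2 := ((SeriesLim.const ((-1) ^ k)).mul ((seriesLim_qp (R := R) 1 one_le_two).comp
    (φ := fun r => k + r) (by simpa [add_comm] using tendsto_shift k))).mul
    (l1.mul ((SeriesLim.const (qr R k)).mul (seriesLim_qr.comp (φ := fun r => 2 * r + k + 1)
      (tendsto_atTop_mono (fun r => by show r ≤ 2 * r + k + 1; omega) tendsto_id))))
  simp only [mul_one, sub_zero, one_mul] at l2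
  convert l2 using 1
  ring

theorem avoids_E2 {r : ℕ} (hr : r % 3 = 1) : Avoids 0 (qpInf R 1 1 * qpInf R 2 2 *
    isum fun n => (-1) ^ n * qp R 1 2 n * ((1 - X ^ (2 * r + 1)) * qrOdd R n r)) := by
  have e : qpInf R 1 1 * qpInf R 2 2 * gaussSeries R r = (-1) ^ r * (X ^ r * theta R) := by
    rw [gaussSeries_eq, gaussSeries_zero, ← theta_eq]
    refine (isUnit_qpInf (R := R) (a := 2) one_le_two 2).mul_left_cancel ?_
    have h1 := qpInf_mul_isum_euler (R := R)
    have h2 := qpInf_mul_qrInf (R := R)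
    have h3 := qpInf_even_odd (R := R)
    set E := isum fun k => (-1) ^ k * qr R k
    rw [neg_pow]
    linear_combination ((-1) ^ r * X ^ r) * ((qpInf R 2 2 ^ 2 * qpInf R 1 2 * E) * h2
      + qpInf R 2 2 * qpInf R 1 2 * h1 + qpInf R 2 2 * qpInf R 1 2 * h3)
  rw [gaussSeries] at e
  rw [e]
  exact (avoids_theta.X_pow_mul _ (by omega)).neg_one_pow_mul _

end QGauss

/-! ### Specializing z and clearing the denominator -/

section Evaluation

variable {R : Type*} [CommRing R]

/-- The ring homomorphism `ℤ[z, z⁻¹]⟦q⟧ → R⟦q⟧` with `z ↦ x`. -/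
noncomputable def evalZ (x : Rˣ) : ZQ →+* R⟦X⟧ :=
  PowerSeries.map (LaurentPolynomial.eval₂ (Int.castRingHom R) x)

theorem evalZ_X (x : Rˣ) : evalZ x X = X := PowerSeries.map_X _

theorem evalZ_qPoch_one (x : Rˣ) (a b n : ℕ) : evalZ x (qPoch 1 a b n) = qp R a b n := by
  simp [qPoch, qp, map_prod, evalZ_X]

theorem seriesLim_qPoch (y : LaurentPolynomial ℤ) (a : ℕ) {b : ℕ} (hb : 1 ≤ b) :
    SeriesLim (qPoch y a b) (qPochInf y a b) := by
  intro N
  filter_upwards [eventually_ge_atTop (N + 1)] with K hK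
  rw [coeff_qPochInf y a b N K hb hK]

theorem evalZ_qPochInf_one (x : Rˣ) (a : ℕ) {b : ℕ} (hb : 1 ≤ b) :
    evalZ x (qPochInf 1 a b) = qpInf R a b :=
  (((seriesLim_qPoch 1 a hb).map _).congr
    (Eventually.of_forall fun n => evalZ_qPoch_one x a b n)).unique (seriesLim_qp a hb)

theorem evalZ_mul_qInv (x : Rˣ) {f : ZQ} (hf : constantCoeff f = 1) :
    evalZ x f * evalZ x (qInv f) = 1 := by
  rw [← map_mul, mul_qInv hf, map_one]

theorem constantCoeff_qPoch_one {a : ℕ} (ha : 1 ≤ a) (b n : ℕ) :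
    constantCoeff (qPoch 1 a b n) = 1 := by
  have : a ≠ 0 := by omega
  simp [qPoch, map_prod, this]

theorem evalZ_qInv_qPoch (x : Rˣ) (n : ℕ) : evalZ x (qInv (qPoch 1 1 1 n)) = qr R n := by
  have h := evalZ_mul_qInv x (constantCoeff_qPoch_one le_rfl 1 n)
  rw [evalZ_qPoch_one] at h
  linear_combination qr R n * h - evalZ x (qInv (qPoch 1 1 1 n)) * qp_mul_qr (R := R) n

theorem evalZ_qInv_qPoch_even (x : Rˣ) (n : ℕ) :
    evalZ x (qInv (qPoch 1 2 2 n)) = qr R (2 * n) * qp R 1 2 n := by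
  have h := evalZ_mul_qInv x (constantCoeff_qPoch_one one_le_two 2 n)
  rw [evalZ_qPoch_one] at h
  have h2 := qp_mul_qr (R := R) (2 * n)
  rw [qp_even_odd] at h2
  linear_combination (qr R (2 * n) * qp R 1 2 n) * h - evalZ x (qInv (qPoch 1 2 2 n)) * h2

theorem evalZ_qSum (x : Rˣ) (f : ℕ → ZQ) :
    evalZ x (qSum f) = isum fun n => if n = 0 then 0 else evalZ x (f n) := by
  ext N
  rw [evalZ, coeff_map, qSum, coeff_mk, isum, coeff_mk, map_sum]
  rw [range_eq_Ico, sum_eq_sum_Ico_succ_bot (Nat.succ_pos N), if_pos rfl, mul_zero, map_zero,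
    zero_add]
  refine sum_congr (by ext; simp) fun n hn => ?_
  rw [if_neg (by simp at hn; omega), ← coeff_map, map_mul, map_pow, PowerSeries.map_X]

theorem evalZ_z (x : Rˣ) : LaurentPolynomial.eval₂ (Int.castRingHom R) x z = x := by
  simp [z]

theorem evalZ_zInv (x : Rˣ) :
    LaurentPolynomial.eval₂ (Int.castRingHom R) x zInv = (x⁻¹ : Rˣ) := by
  rw [zInv, LaurentPolynomial.eval₂_T, zpow_neg_one]

theorem evalZ_qPoch (x : Rˣ) (y : LaurentPolynomial ℤ) (a b n : ℕ) :
    evalZ x (qPoch y a b n) = ∏ j ∈ range n,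
      (1 - C (LaurentPolynomial.eval₂ (Int.castRingHom R) x y) * X ^ (a + b * j)) := by
  simp [qPoch, map_prod, evalZ]

theorem evalZ_qPoch_mul (x : Rˣ) (hx : (x : R) + (x⁻¹ : Rˣ) = -1) (n : ℕ) :
    evalZ x (qPoch z 0 1 n * qPoch zInv 0 1 n)
      = ∏ j ∈ range n, (1 + X ^ j + X ^ (2 * j)) := by
  rw [map_mul, evalZ_qPoch, evalZ_qPoch, evalZ_z, evalZ_zInv, ← prod_mul_distrib]
  refine prod_congr rfl fun j _ => ?_
  have h1 : (C (x : R) * C ((x⁻¹ : Rˣ) : R) : R⟦X⟧) = 1 := by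
    rw [← map_mul, Units.mul_inv, map_one]
  have h2 : (C (x : R) + C ((x⁻¹ : Rˣ) : R) : R⟦X⟧) = -1 := by
    rw [← map_add, hx, map_neg, map_one]
  linear_combination X ^ (2 * j) * h1 - X ^ j * h2

/-- The factor `j = 0` contributes 3, and `(1 - q^j)(1 + q^j + q^{2j}) = 1 - q^{3j}` handles the
others. -/
theorem qp_mul_prod_cube (n : ℕ) :
    qp R 1 1 n * ∏ j ∈ range (n + 1), (1 + X ^ j + X ^ (2 * j)) = 3 * qp R 3 3 n := by
  induction n with
  | zero => simp [qp_zero]; norm_num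
  | succ n ih =>
    rw [prod_range_succ, qp_succ, qp_succ]
    linear_combination (1 - X ^ (1 + 1 * n)) * (1 + X ^ (n + 1) + X ^ (2 * (n + 1))) * ih

theorem qpInf_mul_evalZ (x : Rˣ) (hx : (x : R) + (x⁻¹ : Rˣ) = -1) :
    qpInf R 1 1 * evalZ x (qPochInf z 0 1 * qPochInf zInv 0 1) = 3 * qpInf R 3 3 := by
  have l1 := (((seriesLim_qPoch z 0 le_rfl).mul (seriesLim_qPoch zInv 0 le_rfl)).map
    (LaurentPolynomial.eval₂ (Int.castRingHom R) x)).comp (tendsto_shift 1)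
  refine (((seriesLim_qp 1 le_rfl).mul l1).congr (Eventually.of_forall fun n => ?_)).unique
    ((SeriesLim.const 3).mul (seriesLim_qp 3 (by norm_num)))
  rw [← qp_mul_prod_cube, ← evalZ_qPoch_mul x hx]
  rfl

theorem avoids_qp_three (a : ℕ) (ha : a = 1 ∨ a = 2) (n : ℕ) : Avoids a (qp R 3 3 n) := by
  induction n with
  | zero =>
    rw [qp_zero]
    simpa using avoids_X_pow (R := R) (a := a) (k := 0) (by omega)
  | succ n ih =>
    rw [qp_succ, mul_sub, mul_one, mul_comm _ (X ^ _)]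
    exact ih.sub (ih.X_pow_mul _ (by omega) (by omega))

/-- In the convolution at `N` only exponents `i` divisible by 3 contribute from the product. Those
with `i > 0` meet smaller exponents of `f` in the same class, already zero, leaving 3 times the
coefficient of `f` at `N`. -/
theorem Avoids.of_mul [IsDomain R] (h3 : (3 : R) ≠ 0) {a : ℕ} {f : R⟦X⟧}
    (h : Avoids a (3 * qpInf R 3 3 * f)) : Avoids a f := by
  intro N
  induction N using Nat.strong_induction_on with
  | _ N ih =>
    intro hN
    have h1 := h N hN
    rw [mul_assoc, show (3 : R⟦X⟧) = C 3 from (map_ofNat C 3).symm, coeff_C_mul, coeff_mul,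
      sum_eq_single (0, N)] at h1
    · simpa [constantCoeff_qpInf, h3] using h1
    · rintro ⟨i, j⟩ hij hne
      have hij' := mem_antidiagonal.1 hij
      simp only at hij' ⊢
      by_cases hi : i % 3 = 0
      · rw [ih j (by
          rcases Nat.eq_zero_or_pos i with rfl | hi0
          · exact absurd (by rw [zero_add] at hij'; rw [hij']) hne
          · omega) (by omega), mul_zero]
      · rw [qpInf, coeff_mk, avoids_qp_three (i % 3) (by omega) (i + 1) i rfl, zero_mul]
    · simp

theorem avoids_evalZ_sptCrank [IsDomain R] (h3 : (3 : R) ≠ 0) (x : Rˣ)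
    (hx : (x : R) + (x⁻¹ : Rˣ) = -1) {P : ZQ} {β : ℕ → ZQ} {K : R⟦X⟧} {d : ℕ → R⟦X⟧} {a : ℕ}
    (ha : a < 3) (hP : evalZ x P = K) (hβ : ∀ n, evalZ x (β n) = qr R (2 * n) * d n)
    (h : ∀ r, r % 3 = 1 → Avoids a (qpInf R 1 1 * K *
      isum fun n => d n * ((1 - X ^ (2 * r + 1)) * qrOdd R n r))) :
    Avoids a (evalZ x (sptCrank P β)) := by
  refine Avoids.of_mul h3 ?_
  have h1 := avoids_of_bailey _ d a ha h
  have h2 := congrArg (evalZ x) (qPochInf_mul_sptCrank P β)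
  rw [map_mul, map_mul _ P, evalZ_qSum, hP] at h2
  rw [← qpInf_mul_evalZ x hx, mul_assoc, h2, ← mul_assoc]
  convert h1 using 4 with n
  rw [map_mul, evalZ_qPoch_mul x hx, hβ]
  split_ifs <;> ring

end Evaluation

/-! ### From a cube root of unity to residue classes -/

section CubeRoot

/-- A primitive cube root of unity. -/
noncomputable def cubeRoot : ℂˣ :=
  ⟨⟨-1 / 2, Real.sqrt 3 / 2⟩, ⟨-1 / 2, -(Real.sqrt 3 / 2)⟩,
    by
      have h : Real.sqrt 3 * Real.sqrt 3 = 3 := Real.mul_self_sqrt (by norm_num)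
      apply Complex.ext <;> simp <;> nlinarith,
    by
      have h : Real.sqrt 3 * Real.sqrt 3 = 3 := Real.mul_self_sqrt (by norm_num)
      apply Complex.ext <;> simp <;> nlinarith⟩

theorem cubeRoot_add_inv : (cubeRoot : ℂ) + (cubeRoot⁻¹ : ℂˣ) = -1 := by
  rw [cubeRoot, Units.inv_mk]
  apply Complex.ext <;> simp

theorem cubeRoot_sq : (cubeRoot : ℂ) ^ 2 = -1 - cubeRoot := by
  have h := cubeRoot_add_inv
  have h2 := Units.mul_inv cubeRoot
  linear_combination (cubeRoot : ℂ) * h - h2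

theorem cubeRoot_pow_three : cubeRoot ^ 3 = 1 := by
  ext
  rw [Units.val_pow_eq_pow_val, Units.val_one]
  linear_combination ((cubeRoot : ℂ) - 1) * cubeRoot_sq

theorem eval₂_eq_sum {R : Type*} [CommRing R] (x : Rˣ) (p : LaurentPolynomial ℤ) :
    LaurentPolynomial.eval₂ (Int.castRingHom R) x p
      = ∑ m ∈ p.coeff.support, (p.coeff m : R) * (x ^ m : Rˣ) := by
  have h : LaurentPolynomial.eval₂ (Int.castRingHom R) x p = p.smeval x := by
    induction p using LaurentPolynomial.induction_on' with
    | add p q hp hq => rw [map_add, hp, hq, LaurentPolynomial.smeval_add]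
    | C_mul_T n a =>
      rw [LaurentPolynomial.eval₂_C_mul_T, LaurentPolynomial.smeval_C_mul_T_n, zsmul_eq_mul]
      rfl
  rw [h, LaurentPolynomial.smeval_eq_sum, Finsupp.sum]
  exact sum_congr rfl fun m _ => by rw [zsmul_eq_mul]

theorem Mmod_eq_sum (S : ZQ) (k : ℤ) (t n : ℕ) : Mmod S k t n
    = ∑ m ∈ (coeff n S).coeff.support, if m ≡ k [ZMOD t] then (coeff n S).coeff m else 0 := by
  rw [Mmod, sum_filter]
  rfl

theorem eval_one_eq_Mmod (S : ZQ) (n : ℕ) :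
    coeff n (evalZ (1 : ℤˣ) S) = Mmod S 0 3 n + Mmod S 1 3 n + Mmod S 2 3 n := by
  rw [evalZ, coeff_map, eval₂_eq_sum, Mmod_eq_sum, Mmod_eq_sum, Mmod_eq_sum, ← sum_add_distrib,
    ← sum_add_distrib]
  refine sum_congr rfl fun m _ => ?_
  simp only [Int.ModEq, Nat.cast_ofNat]
  have : m % 3 = 0 ∨ m % 3 = 1 ∨ m % 3 = 2 := by omega
  rcases this with h | h | h <;> simp [h]

theorem eval_cubeRoot_eq_Mmod (S : ZQ) (n : ℕ) :
    coeff n (evalZ cubeRoot S)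
      = Mmod S 0 3 n + Mmod S 1 3 n * cubeRoot + Mmod S 2 3 n * (cubeRoot : ℂ) ^ 2 := by
  rw [evalZ, coeff_map, eval₂_eq_sum, Mmod_eq_sum, Mmod_eq_sum, Mmod_eq_sum]
  push_cast
  rw [sum_mul, sum_mul, ← sum_add_distrib, ← sum_add_distrib]
  refine sum_congr rfl fun m _ => ?_
  have e : cubeRoot ^ m = cubeRoot ^ (m % 3) := by
    conv_lhs => rw [← Int.emod_add_mul_ediv m 3, zpow_add, zpow_mul]
    rw [show cubeRoot ^ (3 : ℤ) = 1 from mod_cast cubeRoot_pow_three, one_zpow, mul_one]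
  have : m % 3 = 0 ∨ m % 3 = 1 ∨ m % 3 = 2 := by omega
  rw [← Units.val_zpow_eq_zpow_val, e]
  rcases this with h | h | h
  · simp [h, Int.ModEq]
  · simp [h, Int.ModEq]
  · simp [h, Int.ModEq, zpow_ofNat]

/-- With `ω² = -1 - ω` the relation reads `(M₀ - M₂) + (M₁ - M₂) ω = 0`; the imaginary part gives
`M₁ = M₂`, then the real part gives `M₀ = M₁`. -/
theorem Mmod_eq_of_coeff_eq_zero {S : ZQ} {n : ℕ} (h : coeff n (evalZ cubeRoot S) = 0) :
    Mmod S 0 3 n = Mmod S 1 3 n ∧ Mmod S 1 3 n = Mmod S 2 3 n := by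
  rw [eval_cubeRoot_eq_Mmod, cubeRoot_sq] at h
  have him := congrArg Complex.im h
  have hre := congrArg Complex.re h
  have h3 : Real.sqrt 3 ≠ 0 := by positivity
  simp [cubeRoot] at him hre
  have h1 : (Mmod S 1 3 n : ℝ) = Mmod S 2 3 n := by
    have : ((Mmod S 1 3 n : ℝ) - Mmod S 2 3 n) * Real.sqrt 3 = 0 := by linarith
    rcases mul_eq_zero.1 this with h | h
    · linarith
    · exact absurd h h3
  have h2 : (Mmod S 0 3 n : ℝ) = Mmod S 1 3 n := by rw [h1] at hre ⊢; linarith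
  exact ⟨by exact_mod_cast h2, by exact_mod_cast h1⟩

theorem Mmod_equidistributed {S : ZQ} {n : ℕ} {spt : ℤ} (h : coeff n (evalZ cubeRoot S) = 0)
    (h1 : coeff n (evalZ (1 : ℤˣ) S) = spt) :
    Mmod S 0 3 n = Mmod S 1 3 n ∧ Mmod S 1 3 n = Mmod S 2 3 n ∧
      (Mmod S 2 3 n : ℚ) = 1 / 3 * (spt : ℚ) := by
  obtain ⟨h2, h3⟩ := Mmod_eq_of_coeff_eq_zero h
  refine ⟨h2, h3, ?_⟩
  rw [← h1, eval_one_eq_Mmod, h2, h3]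
  push_cast
  ring

theorem coeff_SA1 (n : ℕ) : coeff (3 * n) (evalZ cubeRoot SA1) = 0 :=
  avoids_evalZ_sptCrank (by norm_num) _ cubeRoot_add_inv (by norm_num)
    (evalZ_qPochInf_one _ 1 le_rfl)
    (fun n => by rw [betaA1, evalZ_qInv_qPoch, mul_one]) (fun _ => avoids_A1) _ (by omega)

theorem coeff_SA3 (n : ℕ) : coeff (3 * n + 1) (evalZ cubeRoot SA3) = 0 :=
  avoids_evalZ_sptCrank (by norm_num) _ cubeRoot_add_inv (by norm_num)
    (evalZ_qPochInf_one _ 1 le_rfl)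
    (fun n => by rw [betaA3, map_mul, map_pow, evalZ_X, evalZ_qInv_qPoch, mul_comm])
    (fun _ => avoids_A3) _ (by omega)

theorem coeff_SE2 (n : ℕ) : coeff (3 * n) (evalZ cubeRoot SE2) = 0 :=
  avoids_evalZ_sptCrank (by norm_num) _ cubeRoot_add_inv (by norm_num)
    (evalZ_qPochInf_one _ 2 one_le_two)
    (fun n => by
      rw [betaE2, map_mul, map_pow, map_neg, map_one, evalZ_qInv_qPoch_even]; ring)
    (fun _ => avoids_E2) _ (by omega)

theorem coeff_SE4 (n : ℕ) : coeff (3 * n + 1) (evalZ cubeRoot SE4) = 0 :=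
  avoids_evalZ_sptCrank (by norm_num) _ cubeRoot_add_inv (by norm_num)
    (evalZ_qPochInf_one _ 2 one_le_two)
    (fun n => by rw [betaE4, map_mul, map_pow, evalZ_X, evalZ_qInv_qPoch_even]; ring)
    (fun _ => avoids_E4) _ (by omega)

end CubeRoot

/-! ### Partitions sorted by smallest part -/

section Smallest

theorem smallest_mem {s : Multiset ℕ} (h : s ≠ 0) : smallest s ∈ s := by
  have hne : s.toFinset.Nonempty := Multiset.toFinset_nonempty.2 h
  rw [smallest, ← coe_min' hne, WithTop.untopD_coe, ← Multiset.mem_toFinset]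
  exact min'_mem _ hne

theorem smallest_le {s : Multiset ℕ} {a : ℕ} (h : a ∈ s) : smallest s ≤ a := by
  have hne : s.toFinset.Nonempty := ⟨a, Multiset.mem_toFinset.2 h⟩
  rw [smallest, ← coe_min' hne, WithTop.untopD_coe]
  exact min'_le _ _ (Multiset.mem_toFinset.2 h)

theorem smallest_zero : smallest 0 = 0 := rfl

/-- Character for partitions with all parts at least `s`: a part `s` occurring `c` times has
weight `g c`, and all other parts have weight `h`. -/
def charFrom (s : ℕ) (g : ℕ → ℤ) (h : ℤ) (i c : ℕ) : ℤ :=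
  if i < s then 0 else if i = s then g c else h

/-- Character for partitions with all parts larger than `s`. -/
def charAbove (s : ℕ) (h : ℤ) (i _c : ℕ) : ℤ := if i ≤ s then 0 else h

/-- The first product also counts partitions whose parts all exceed `s`, because a part that does
not occur contributes no factor; the second product removes them. The exponent of `h` counts the
other part sizes: `h = 1` gives partitions and `h = 2` the choices of overlines. -/
theorem prod_char_sub {N : ℕ} (p : N.Partition) {s : ℕ} (hs : 1 ≤ s) (g : ℕ → ℤ) (h : ℤ) :
    p.parts.toFinsupp.prod (charFrom s g h) - p.parts.toFinsupp.prod (charAbove s h)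
      = if smallest p.parts = s then
          g (smallestCount p.parts) * h ^ (p.parts.toFinset.card - 1) else 0 := by
  simp only [Finsupp.prod, Multiset.toFinsupp_support, Multiset.toFinsupp_apply]
  by_cases h0 : p.parts = 0
  · rw [h0, smallest_zero, if_neg (by omega)]
    simp
  have hm := smallest_mem h0
  have hm' := Multiset.mem_toFinset.2 hm
  split_ifs with he
  · have z1 : ∏ a ∈ p.parts.toFinset, charAbove s h a (p.parts.count a) = 0 := prod_eq_zero hm' (if_pos he.le)
    rw [z1, sub_zero,
      ← mul_prod_erase _ _ hm', charFrom, if_neg (by omega), if_pos he, smallestCount,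
      ← card_erase_of_mem hm', ← prod_const]
    congr 1
    refine prod_congr rfl fun i hi => ?_
    have hi' := mem_erase.1 hi
    have := smallest_le (Multiset.mem_toFinset.1 hi'.2)
    rw [charFrom, if_neg (by omega), if_neg (by omega)]
  · rcases lt_or_gt_of_ne he with hlt | hgt
    · have z1 : ∏ a ∈ p.parts.toFinset, charAbove s h a (p.parts.count a) = 0 :=
        prod_eq_zero hm' (if_pos hlt.le)
      have z2 : ∏ a ∈ p.parts.toFinset, charFrom s g h a (p.parts.count a) = 0 :=
        prod_eq_zero hm' (if_pos hlt)
      rw [z1, z2, sub_zero]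
    · rw [sub_eq_zero]
      refine prod_congr rfl fun i hi => ?_
      have := smallest_le (Multiset.mem_toFinset.1 hi)
      rw [charFrom, charAbove, if_neg (by omega), if_neg (by omega), if_neg (by omega)]

/-- The generating function of partitions with smallest part `s`. -/
noncomputable def genSmallest (s : ℕ) (g : ℕ → ℤ) (h : ℤ) : ℤ⟦X⟧ :=
  Nat.Partition.genFun (charFrom s g h) - Nat.Partition.genFun (charAbove s h)

theorem coeff_genSmallest (N : ℕ) {s : ℕ} (hs : 1 ≤ s) (g : ℕ → ℤ) (h : ℤ) :
    coeff N (genSmallest s g h) = ∑ p : N.Partition, if smallest p.parts = s then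
      g (smallestCount p.parts) * h ^ (p.parts.toFinset.card - 1) else 0 := by
  rw [genSmallest, map_sub, Nat.Partition.coeff_genFun, Nat.Partition.coeff_genFun,
    ← sum_sub_distrib]
  exact sum_congr rfl fun p _ => prod_char_sub p hs g h

theorem sum_ite_smallest {N K : ℕ} (hK : N ≤ K) (p : N.Partition) (φ : ℕ → ℤ) :
    ∑ s ∈ Icc 1 K, (if smallest p.parts = s then φ s else 0)
      = if p.parts ≠ 0 then φ (smallest p.parts) else 0 := by
  rw [sum_ite_eq]
  by_cases h0 : p.parts = 0
  -- The empty partition has default smallest part 0, which lies outside the range starting at 1.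
  · simp [h0, smallest_zero]
  · have hm := smallest_mem h0
    have h1 := p.parts_pos hm
    have h2 : smallest p.parts ≤ N := by
      conv_rhs => rw [← p.parts_sum]
      exact Multiset.le_sum_of_mem hm
    rw [if_pos h0, if_pos (mem_Icc.2 ⟨h1, h2.trans hK⟩)]

theorem sum_overpartitions (N : ℕ) (g : ℕ → ℤ) (w : ℕ → ℤ) :
    ∑ p ∈ overpartitions N, w (smallest p.1.parts) * g (smallestCount p.1.parts)
      = ∑ s ∈ Icc 1 N, w s * coeff N (genSmallest s g 2) := by
  have e : ∀ s ∈ Icc 1 N, w s * coeff N (genSmallest s g 2) = ∑ p : N.Partition,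
      if smallest p.parts = s then
        w s * (g (smallestCount p.parts) * 2 ^ (p.parts.toFinset.card - 1)) else 0 := by
    intro s hs
    rw [coeff_genSmallest N (mem_Icc.1 hs).1, mul_sum]
    exact sum_congr rfl fun p _ => by split_ifs <;> simp
  rw [sum_congr rfl e, sum_comm, overpartitions, sum_filter, sum_sigma]
  refine sum_congr rfl fun p _ => ?_
  rw [sum_ite_smallest le_rfl p fun s =>
    w s * (g (smallestCount p.parts) * 2 ^ (p.parts.toFinset.card - 1))]
  by_cases h0 : p.parts = 0
  · simp [h0]
  · simp only [ne_eq, h0, not_false_eq_true, true_and, if_true]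
    rw [← sum_filter, sum_const]
    -- Every size except the smallest may be overlined freely, giving the power of 2.
    have hc : (p.parts.toFinset.powerset.filter fun T => smallest p.parts ∉ T)
        = (p.parts.toFinset.erase (smallest p.parts)).powerset := by
      ext T
      simp only [mem_filter, mem_powerset, subset_erase]
    rw [hc, card_powerset, card_erase_of_mem (Multiset.mem_toFinset.2 (smallest_mem h0)),
      nsmul_eq_mul]
    push_cast
    ring

/-- Character for partitions with all parts in `(s, 2 s]`. -/
def charBetween (s : ℕ) (i _c : ℕ) : ℤ := if s < i ∧ i ≤ 2 * s then 1 else 0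

theorem coeff_genFun_charBetween (N s : ℕ) :
    coeff N (Nat.Partition.genFun (charBetween s))
      = ∑ p : N.Partition, if ∀ a ∈ p.parts, s < a ∧ a ≤ 2 * s then 1 else 0 := by
  rw [Nat.Partition.coeff_genFun]
  refine sum_congr rfl fun p _ => ?_
  simp only [Finsupp.prod, Multiset.toFinsupp_support, charBetween, prod_boole,
    Multiset.mem_toFinset]

theorem sum_partitionPairs (N : ℕ) (g : ℕ → ℤ) :
    ∑ p ∈ partitionPairs N, g (smallestCount p.2.1.parts)
      = ∑ s ∈ Icc 1 N, coeff N (genSmallest s g 1 * Nat.Partition.genFun (charBetween s)) := by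
  have e : ∀ s ∈ Icc 1 N,
      coeff N (genSmallest s g 1 * Nat.Partition.genFun (charBetween s))
        = ∑ i ∈ antidiagonal N, ∑ p : i.1.Partition × i.2.Partition,
          if smallest p.1.parts = s then (if ∀ a ∈ p.2.parts, s < a ∧ a ≤ 2 * s then
            g (smallestCount p.1.parts) else 0) else 0 := by
    intro s hs
    rw [coeff_mul]
    refine sum_congr rfl fun i _ => ?_
    rw [coeff_genSmallest _ (mem_Icc.1 hs).1, coeff_genFun_charBetween, sum_mul_sum,
      Fintype.sum_prod_type]
    refine sum_congr rfl fun p _ => sum_congr rfl fun p' _ => ?_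
    split_ifs <;> simp
  rw [sum_congr rfl e, sum_comm, partitionPairs, sum_filter, sum_sigma]
  refine sum_congr rfl fun i hi => ?_
  rw [sum_comm]
  refine sum_congr rfl fun p _ => ?_
  rw [sum_ite_smallest (by have := mem_antidiagonal.1 hi; omega) p.1 fun s =>
    if ∀ a ∈ p.2.parts, s < a ∧ a ≤ 2 * s then g (smallestCount p.1.parts) else 0, ite_and]

end Smallest

/-! ### Product formulas for the generating functions -/

section GenFun

open scoped PowerSeries.WithPiTopology

/-- `∑_{j ≥ 1} a_j q^{m j}`. -/
noncomputable def dilatedSum (a : ℕ → ℤ) (m : ℕ) : ℤ⟦X⟧ :=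
  ∑' j, a (j + 1) • (X : ℤ⟦X⟧) ^ (m * (j + 1))

theorem summable_dilated (a : ℕ → ℤ) {m : ℕ} (hm : m ≠ 0) :
    Summable fun j => a (j + 1) • (X : ℤ⟦X⟧) ^ (m * (j + 1)) :=
  Nat.Partition.summable_genFun_term' (fun _ c => a c) hm

theorem dilatedSum_eq (a : ℕ → ℤ) {m : ℕ} (hm : m ≠ 0) :
    dilatedSum a m = a 1 • X ^ m + X ^ m * dilatedSum (fun j => a (j + 1)) m := by
  rw [dilatedSum, (summable_dilated a hm).tsum_eq_zero_add, dilatedSum,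
    ← (summable_dilated (fun j => a (j + 1)) hm).tsum_mul_left]
  congr 1
  · simp
  · congr 1
    funext j
    rw [mul_smul_comm, ← pow_add]
    ring_nf

theorem dilatedSum_add (a b : ℕ → ℤ) {m : ℕ} (hm : m ≠ 0) :
    dilatedSum (fun j => a j + b j) m = dilatedSum a m + dilatedSum b m := by
  simp only [dilatedSum, add_smul]
  exact (summable_dilated a hm).tsum_add (summable_dilated b hm)

theorem dilatedSum_zero (m : ℕ) : dilatedSum (fun _ => 0) m = 0 := by simp [dilatedSum]

theorem dilatedSum_const (h : ℤ) {m : ℕ} (hm : m ≠ 0) :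
    dilatedSum (fun _ => h) m * (1 - X ^ m) = h • X ^ m := by
  have := dilatedSum_eq (fun _ => h) hm
  linear_combination this

theorem dilatedSum_id {m : ℕ} (hm : m ≠ 0) :
    dilatedSum (fun c => (c : ℤ)) m * (1 - X ^ m) ^ 2 = X ^ m := by
  have h1 := dilatedSum_eq (fun c => (c : ℤ)) hm
  have h2 := dilatedSum_const 1 hm
  have h3 := dilatedSum_add (fun c => (c : ℤ)) (fun _ => 1) hm
  push_cast at h1
  rw [h3, one_smul] at h1
  rw [one_smul] at h2
  linear_combination (1 - X ^ m) * h1 + X ^ m * h2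

theorem dilatedSum_pred {m : ℕ} (hm : m ≠ 0) :
    dilatedSum (fun c => (c : ℤ) - 1) m * (1 - X ^ m) ^ 2 = X ^ m * X ^ m := by
  have h1 := dilatedSum_eq (fun c => (c : ℤ) - 1) hm
  push_cast at h1
  simp only [zero_smul, zero_add, add_sub_cancel_right] at h1
  rw [h1, mul_assoc, dilatedSum_id hm]

theorem seriesLim_genFun (f : ℕ → ℕ → ℤ) :
    SeriesLim (fun K => ∏ i ∈ range K, (1 + dilatedSum (f (i + 1)) (i + 1)))
      (Nat.Partition.genFun f) := by
  intro N
  have h := ((WithPiTopology.tendsto_iff_coeff_tendsto ℤ _ _ _).1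
    (Nat.Partition.hasProd_genFun f).tendsto_prod_nat) N
  rw [nhds_discrete, tendsto_pure] at h
  exact h

theorem genSmallest_eq {s : ℕ} (hs : 1 ≤ s) (g : ℕ → ℤ) (h : ℤ) :
    genSmallest s g h = dilatedSum g s * Nat.Partition.genFun (charAbove s h) := by
  have e : Nat.Partition.genFun (charFrom s g h)
      = (1 + dilatedSum g s) * Nat.Partition.genFun (charAbove s h) := by
    refine (seriesLim_genFun _).unique (((SeriesLim.const _).mul (seriesLim_genFun _)).congr ?_)
    filter_upwards [eventually_ge_atTop s] with K hK
    -- The two products differ only in the factor of part size `s`, which has index `s - 1`.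
    have e1 : ∀ i ∈ range K, 1 + dilatedSum (charFrom s g h (i + 1)) (i + 1)
        = (if i = s - 1 then 1 + dilatedSum g s else 1) *
          (1 + dilatedSum (charAbove s h (i + 1)) (i + 1)) := by
      intro i _
      rcases lt_trichotomy (i + 1) s with hi | hi | hi
      · have a1 : charFrom s g h (i + 1) = fun _ => 0 := by
          funext c; rw [charFrom, if_pos hi]
        have a2 : charAbove s h (i + 1) = fun _ => 0 := by
          funext c; rw [charAbove, if_pos hi.le]
        rw [a1, a2, if_neg (by omega), one_mul]
      · have a1 : charFrom s g h (i + 1) = g := by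
          funext c; rw [charFrom, if_neg (by omega), if_pos hi]
        have a2 : charAbove s h (i + 1) = fun _ => 0 := by
          funext c; rw [charAbove, if_pos hi.le]
        rw [a1, a2, if_pos (by omega), dilatedSum_zero, add_zero, mul_one, hi]
      · have a1 : charFrom s g h (i + 1) = fun _ => h := by
          funext c; rw [charFrom, if_neg (by omega), if_neg (by omega)]
        have a2 : charAbove s h (i + 1) = fun _ => h := by
          funext c; rw [charAbove, if_neg (by omega)]
        rw [a1, a2, if_neg (by omega), one_mul]
    rw [prod_congr rfl e1, prod_mul_distrib, prod_ite_eq', if_pos (mem_range.2 (by omega))]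
  rw [genSmallest, e]
  ring

theorem seriesLim_genFun_charAbove (s : ℕ) (h : ℤ) :
    SeriesLim (fun m => ∏ j ∈ range m, (1 + dilatedSum (fun _ => h) (s + 1 + j)))
      (Nat.Partition.genFun (charAbove s h)) := by
  refine ((seriesLim_genFun (charAbove s h)).comp (φ := fun m => s + m)
    (by simpa [add_comm] using tendsto_shift s)).congr (Eventually.of_forall fun m => ?_)
  rw [prod_range_add, prod_eq_one, one_mul]
  · refine prod_congr rfl fun j _ => ?_
    have a2 : charAbove s h (s + j + 1) = fun _ => h := by
      funext c; rw [charAbove, if_neg (by omega)]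
    rw [a2, show s + j + 1 = s + 1 + j by ring]
  · intro i hi
    have a2 : charAbove s h (i + 1) = fun _ => 0 := by
      funext c; rw [charAbove, if_pos (Nat.succ_le_of_lt (mem_range.1 hi))]
    rw [a2, dilatedSum_zero, add_zero]

theorem genFun_charAbove_one (s : ℕ) :
    Nat.Partition.genFun (charAbove s 1) * qpInf ℤ (s + 1) 1 = 1 := by
  refine (((seriesLim_genFun_charAbove s 1).mul (seriesLim_qp (s + 1) le_rfl)).congr
    (Eventually.of_forall fun m => ?_)).unique (SeriesLim.const 1)
  rw [qp, ← prod_mul_distrib]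
  refine prod_eq_one fun j _ => ?_
  have := dilatedSum_const 1 (m := s + 1 + j) (by omega)
  rw [one_smul] at this
  rw [one_mul j]
  linear_combination this

/-- Each size `j > s` contributes `1 + 2 q^j / (1 - q^j) = (1 - q^{2j}) / (1 - q^j)²`. -/
theorem genFun_charAbove_two (s : ℕ) :
    Nat.Partition.genFun (charAbove s 2) * qpInf ℤ (s + 1) 1 ^ 2 = qpInf ℤ (2 * s + 2) 2 := by
  rw [sq]
  refine (((seriesLim_genFun_charAbove s 2).mul ((seriesLim_qp (s + 1) le_rfl).mul
    (seriesLim_qp (s + 1) le_rfl))).congr (Eventually.of_forall fun m => ?_)).unique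
    (seriesLim_qp (2 * s + 2) one_le_two)
  rw [qp, qp, ← prod_mul_distrib, ← prod_mul_distrib]
  refine prod_congr rfl fun j _ => ?_
  have := dilatedSum_const 2 (m := s + 1 + j) (by omega)
  rw [ofNat_smul_eq_nsmul, nsmul_eq_mul] at this
  rw [one_mul j]
  push_cast at this
  linear_combination (1 - X ^ (s + 1 + j)) * this

theorem genFun_charBetween (s : ℕ) :
    Nat.Partition.genFun (charBetween s) * qp ℤ (s + 1) 1 s = 1 := by
  refine ((((seriesLim_genFun (charBetween s)).comp (φ := fun m => s + s + m)
    (by simpa [add_comm] using tendsto_shift (s + s))).mul (SeriesLim.const _)).congr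
    (Eventually.of_forall fun m => ?_)).unique (SeriesLim.const 1)
  rw [prod_range_add, prod_range_add, prod_eq_one (s := range s), one_mul,
    prod_eq_one (s := range m), mul_one, qp, ← prod_mul_distrib]
  · refine prod_eq_one fun j hj => ?_
    have hj' := mem_range.1 hj
    have a2 : charBetween s (s + j + 1) = fun _ => 1 := by
      funext c; rw [charBetween, if_pos (by omega)]
    have := dilatedSum_const 1 (m := s + j + 1) (by omega)
    rw [one_smul] at this
    rw [a2, one_mul j, show s + 1 + j = s + j + 1 by ring]
    linear_combination this
  · intro i hi
    have a2 : charBetween s (s + s + i + 1) = fun _ => 0 := by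
      funext c; rw [charBetween, if_neg (by omega)]
    rw [a2, dilatedSum_zero, add_zero]
  · intro i hi
    have hi' := mem_range.1 hi
    have a2 : charBetween s (i + 1) = fun _ => 0 := by
      funext c; rw [charBetween, if_neg (by omega)]
    rw [a2, dilatedSum_zero, add_zero]

end GenFun

/-! ### The series at z = 1 -/

section Spt

theorem evalZ_one_qPochInf (y : LaurentPolynomial ℤ)
    (hy : LaurentPolynomial.eval₂ (Int.castRingHom ℤ) 1 y = 1) (a : ℕ) {b : ℕ} (hb : 1 ≤ b) :
    evalZ (1 : ℤˣ) (qPochInf y a b) = qpInf ℤ a b := by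
  refine (((seriesLim_qPoch y a hb).map _).congr
    (Eventually.of_forall fun n => ?_)).unique (seriesLim_qp a hb)
  change evalZ (1 : ℤˣ) (qPoch y a b n) = _
  rw [evalZ_qPoch, hy]
  simp [qp]

theorem qpInf_step (a : ℕ) : qpInf ℤ a 1 = (1 - X ^ a) * qpInf ℤ (a + 1) 1 := by
  rw [qpInf_eq_mul' a le_rfl 1]
  simp [qp]

/-- The `n`-th term of the series at `z = 1`. -/
theorem coeff_evalZ_one_sptCrank {P : ZQ} {β : ℕ → ZQ} {t : ℕ → ℤ⟦X⟧}
    (h : ∀ n, 1 ≤ n → X ^ n * (evalZ (1 : ℤˣ) P * evalZ (1 : ℤˣ) (β n))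
      = t n * ((1 - X ^ n) ^ 2 * qpInf ℤ (n + 1) 1 ^ 2)) (N : ℕ) :
    coeff N (evalZ (1 : ℤˣ) (sptCrank P β)) = ∑ n ∈ Icc 1 N, coeff N (t n) := by
  rw [sptCrank, evalZ, coeff_map, qSum, coeff_mk, map_sum]
  refine sum_congr rfl fun n hn => ?_
  have hn' := (mem_Icc.1 hn).1
  rw [← coeff_map]
  congr 1
  change evalZ (1 : ℤˣ) _ = _
  -- The term must be used in its form starting at `q^n`: the full product `(z; q)_∞` vanishes at z
  -- = 1, whereas `(q^n; q)_∞` is invertible for `n ≥ 1`.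
  have h1 := evalZ_mul_qInv (1 : ℤˣ) (f := qPochInf z n 1 * qPochInf zInv n 1)
    (by rw [map_mul, constantCoeff_qPochInf _ n 1 hn', constantCoeff_qPochInf _ n 1 hn', mul_one])
  rw [map_mul, evalZ_one_qPochInf z (by simp [z]) n le_rfl,
    evalZ_one_qPochInf zInv (by simp [zInv]) n le_rfl, qpInf_step n] at h1
  rw [map_mul, map_mul, map_mul, map_pow, evalZ_X, ← mul_assoc, h n hn']
  linear_combination t n * h1

theorem spt_A {g : ℕ → ℤ} {β : ℕ → ZQ} {b : ℕ → ℤ⟦X⟧}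
    (hβ : ∀ n, evalZ (1 : ℤˣ) (β n) = b n * qr ℤ (2 * n))
    (hg : ∀ n, n ≠ 0 → dilatedSum g n * (1 - X ^ n) ^ 2 = X ^ n * b n) (N : ℕ) :
    coeff N (evalZ (1 : ℤˣ) (sptCrank (qPochInf 1 1 1) β))
      = ∑ p ∈ partitionPairs N, g (smallestCount p.2.1.parts) := by
  rw [sum_partitionPairs]
  refine coeff_evalZ_one_sptCrank (fun n hn => ?_) N
  rw [evalZ_qPochInf_one _ 1 le_rfl, hβ, genSmallest_eq hn]
  have h1 := hg n (by omega)
  have h2 := genFun_charAbove_one n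
  have h3 := genFun_charBetween n
  have h4 := qpInf_eq_mul' (R := ℤ) 1 le_rfl (2 * n)
  have h5 := qpInf_eq_mul' (R := ℤ) (n + 1) le_rfl n
  have h6 := qp_mul_qr (R := ℤ) (2 * n)
  rw [show 1 + 1 * (2 * n) = n + 1 + 1 * n by ring] at h4
  set G := Nat.Partition.genFun (charAbove n 1)
  set H := Nat.Partition.genFun (charBetween n)
  set Q := qpInf ℤ (n + 1 + 1 * n) 1
  set U := qpInf ℤ (n + 1) 1
  rw [h4]
  -- Rests on `(q; q)_∞ / (q; q)_{2n} = (q^{2n+1}; q)_∞ = (q^{n+1}; q)_∞ / (q^{n+1}; q)_n`: one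
  -- factor `1 / (q^{n+1}; q)_∞` is left for the first partition, and `1 / (q^{n+1}; q)_n` gives the
  -- parts of the second.
  linear_combination X ^ n * b n * Q * h6 - G * H * U ^ 2 * h1 - X ^ n * b n * H * U * h2
    - X ^ n * b n * H * h5 - X ^ n * b n * Q * h3

theorem spt_E {g w : ℕ → ℤ} {β : ℕ → ZQ} {b : ℕ → ℤ⟦X⟧}
    (hβ : ∀ n, evalZ (1 : ℤˣ) (β n) = b n * (qr ℤ (2 * n) * qp ℤ 1 2 n))
    (hg : ∀ n, n ≠ 0 → C (w n) * dilatedSum g n * (1 - X ^ n) ^ 2 = X ^ n * b n) (N : ℕ) :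
    coeff N (evalZ (1 : ℤˣ) (sptCrank (qPochInf 1 2 2) β))
      = ∑ p ∈ overpartitions N, w (smallest p.1.parts) * g (smallestCount p.1.parts) := by
  rw [sum_overpartitions, coeff_evalZ_one_sptCrank (t := fun n => C (w n) * genSmallest n g 2)]
  · exact sum_congr rfl fun n _ => coeff_C_mul _ _ _
  intro n hn
  rw [evalZ_qPochInf_one _ 2 one_le_two, hβ, genSmallest_eq hn]
  have h1 := hg n (by omega)
  have h2 := genFun_charAbove_two n
  have h4 := qpInf_eq_mul' (R := ℤ) 2 one_le_two n
  have h6 := qp_mul_qr (R := ℤ) (2 * n)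
  rw [qp_even_odd] at h6
  rw [show 2 + 2 * n = 2 * n + 2 by ring] at h4
  set G := Nat.Partition.genFun (charAbove n 2)
  set Q := qpInf ℤ (2 * n + 2) 2
  set U := qpInf ℤ (n + 1) 1
  rw [h4]
  -- Here `(q²; q²)_∞ / (q²; q²)_n = (q^{2n+2}; q²)_∞`, which over `(q^{n+1}; q)_∞²` generates
  -- overpartitions with parts above `n`.
  linear_combination X ^ n * b n * Q * h6 - G * U ^ 2 * h1 - X ^ n * b n * h2

theorem coeff_SA1_eq_spt (N : ℕ) : coeff N (evalZ (1 : ℤˣ) SA1) = sptA1 N :=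
  spt_A (g := fun c => (c : ℤ)) (b := fun _ => 1)
    (fun n => by rw [betaA1, evalZ_qInv_qPoch, one_mul])
    (fun n hn => by rw [dilatedSum_id hn, mul_one]) N

theorem coeff_SA3_eq_spt (N : ℕ) : coeff N (evalZ (1 : ℤˣ) SA3) = sptA3 N :=
  spt_A (g := fun c => (c : ℤ) - 1) (b := fun n => X ^ n)
    (fun n => by rw [betaA3, map_mul, map_pow, evalZ_X, evalZ_qInv_qPoch])
    (fun n hn => by rw [dilatedSum_pred hn]) N

theorem coeff_SE2_eq_spt (N : ℕ) : coeff N (evalZ (1 : ℤˣ) SE2) = sptE2 N :=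
  spt_E (g := fun c => (c : ℤ)) (w := fun n => (-1) ^ n) (b := fun n => (-1) ^ n)
    (fun n => by rw [betaE2, map_mul, map_pow, map_neg, map_one, evalZ_qInv_qPoch_even])
    (fun n hn => by
      rw [mul_assoc, dilatedSum_id hn, map_pow, map_neg, map_one, mul_comm]) N

theorem coeff_SE4_eq_spt (N : ℕ) : coeff N (evalZ (1 : ℤˣ) SE4) = sptE4 N := by
  have h := spt_E (g := fun c => (c : ℤ) - 1) (w := fun _ => 1) (b := fun n => X ^ n)
    (β := betaE4)
    (fun n => by rw [betaE4, map_mul, map_pow, evalZ_X, evalZ_qInv_qPoch_even])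
    (fun n hn => by rw [map_one, one_mul, dilatedSum_pred hn]) N
  rw [SE4, h, sptE4]
  simp only [one_mul]

end Spt

end SptCrank

theorem mainTheorem10 (n : ℕ) :
    (SptCrank.Mmod SptCrank.SA1 0 3 (3 * n) = SptCrank.Mmod SptCrank.SA1 1 3 (3 * n) ∧
      SptCrank.Mmod SptCrank.SA1 1 3 (3 * n) = SptCrank.Mmod SptCrank.SA1 2 3 (3 * n) ∧
      (SptCrank.Mmod SptCrank.SA1 2 3 (3 * n) : ℚ) = 1 / 3 * (SptCrank.sptA1 (3 * n) : ℚ)) ∧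
    (SptCrank.Mmod SptCrank.SA3 0 3 (3 * n + 1) = SptCrank.Mmod SptCrank.SA3 1 3 (3 * n + 1) ∧
      SptCrank.Mmod SptCrank.SA3 1 3 (3 * n + 1) = SptCrank.Mmod SptCrank.SA3 2 3 (3 * n + 1) ∧
      (SptCrank.Mmod SptCrank.SA3 2 3 (3 * n + 1) : ℚ) = 1 / 3 * (SptCrank.sptA3 (3 * n + 1) : ℚ)) ∧
    (SptCrank.Mmod SptCrank.SE2 0 3 (3 * n) = SptCrank.Mmod SptCrank.SE2 1 3 (3 * n) ∧
      SptCrank.Mmod SptCrank.SE2 1 3 (3 * n) = SptCrank.Mmod SptCrank.SE2 2 3 (3 * n) ∧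
      (SptCrank.Mmod SptCrank.SE2 2 3 (3 * n) : ℚ) = 1 / 3 * (SptCrank.sptE2 (3 * n) : ℚ)) ∧
    (SptCrank.Mmod SptCrank.SE4 0 3 (3 * n + 1) = SptCrank.Mmod SptCrank.SE4 1 3 (3 * n + 1) ∧
      SptCrank.Mmod SptCrank.SE4 1 3 (3 * n + 1) = SptCrank.Mmod SptCrank.SE4 2 3 (3 * n + 1) ∧
      (SptCrank.Mmod SptCrank.SE4 2 3 (3 * n + 1) : ℚ) = 1 / 3 * (SptCrank.sptE4 (3 * n + 1) : ℚ)) :=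
  ⟨SptCrank.Mmod_equidistributed (SptCrank.coeff_SA1 n) (SptCrank.coeff_SA1_eq_spt _),
    SptCrank.Mmod_equidistributed (SptCrank.coeff_SA3 n) (SptCrank.coeff_SA3_eq_spt _),
    SptCrank.Mmod_equidistributed (SptCrank.coeff_SE2 n) (SptCrank.coeff_SE2_eq_spt _),
    SptCrank.Mmod_equidistributed (SptCrank.coeff_SE4 n) (SptCrank.coeff_SE4_eq_spt _)⟩
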